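/- Let $k$ be an algebraically closed field and let $\mathcal A$ be a finite multitensor category over $k$: a $k$-linear category that is equivalent, as a $k$-linear category, to the category of finite-dimensional modules over some finite-dimensional $k$-algebra, together with a rigid monoidal structure whose tensor product is $k$-bilinear on morphisms (the unit $\mathbf 1$ is not assumed to be simple; the case $\operatorname{End}(\mathbf 1)=k$ is that of a finite tensor category). Write $x^\vee$ for the right dual of $x$, with evaluation $x^\vee\otimes x\to\mathbf 1$ and coevaluation $\mathbf 1\to x\otimes x^\vee$, and ${}^\vee x$ for the left dual, with evaluation $x\otimes{}^\vee x\to\mathbf 1$ and coevaluation $\mathbf 1\to{}^\vee x\otimes x$. For a finite-dimensional vector space $V$ and $a\in\mathcal A$ let $V\otimes a\in\mathcal A$ be the object with $\operatorname{Hom}(V\otimes a,y)\cong\operatorname{Hom}_k(V,\operatorname{Hom}(a,y))$, and let $V^*$ be the linear dual of $V$. Then the ends and coends $$N^l_{\mathcal A}(x)=\int_{a\in\mathcal A}\operatorname{Hom}(a,x)\otimes a,\qquad N^r_{\mathcal A}(x)=\int^{a\in\mathcal A}\operatorname{Hom}(x,a)^*\otimes a$$ exist for all $x\in\mathcal A$.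 Put $$D:=N^l_{\mathcal A}(\mathbf 1)=\int_{a\in\mathcal A}\operatorname{Hom}(a,\mathbf 1)\otimes a,\qquad \widetilde D:=N^r_{\mathcal A}(\mathbf 1)=\int^{a\in\mathcal A}\operatorname{Hom}(\mathbf 1,a)^*\otimes a .$$ There are natural isomorphisms of endofunctors of $\mathcal A$ $$N^l_{\mathcal A}\cong D\otimes{}^{\vee\vee}(-)\cong(-)^{\vee\vee}\otimes D,\qquad N^r_{\mathcal A}\cong\widetilde D\otimes(-)^{\vee\vee}\cong{}^{\vee\vee}(-)\otimes\widetilde D .$$ The object $D$ is invertible for the tensor product, with inverse $\widetilde D$, and the quadruple dual functor is naturally isomorphic to conjugation by $D$: for every inverse $D^{-1}$ of $D$, that is, every object with $D\otimes D^{-1}\cong\mathbf 1\cong D^{-1}\otimes D$, $$(-)^{\vee\vee\vee\vee}\cong D\otimes-\otimes D^{-1}.$$ -/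

import Mathlib

open CategoryTheory CategoryTheory.Limits CategoryTheory.MonoidalCategory Opposite

universe w v u

noncomputable section

namespace FiniteMultitensor

/-! ### Finite linear categories -/

/-- A `k`-linear category is *finite* if it is equivalent, by a `k`-linear functor, to the
category of finite-dimensional left modules over some finite-dimensional `k`-algebra `B`.
(Over such a `B`, finitely generated and finite-dimensional modules are the same.) -/
class IsFiniteLinear (k : Type w) [Field k] (C : Type u) [Category.{v} C] [Preadditive C]
    [Linear k C] : Prop where
  exists_equivalence : ∃ (B : Type w) (_ : Ring B) (_ : Algebra k B) (_ : FiniteDimensional k B)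
    (F : C ⥤ FGModuleCat.{w} B) (_ : F.Additive), F.Linear k ∧ F.IsEquivalence

lemma fgModule_finite_hom (k : Type w) [Field k] (B : Type w) [Ring B] [Algebra k B]
    [FiniteDimensional k B] (M N : FGModuleCat.{w} B) : Module.Finite k (M ⟶ N) := by
  let _ : Module k M.obj := ModuleCat.moduleOfAlgebraModule M.obj
  let _ : Module k N.obj := ModuleCat.moduleOfAlgebraModule N.obj
  have : IsScalarTower k B M.obj := ModuleCat.isScalarTower_of_algebra_moduleCat M.obj
  have : IsScalarTower k B N.obj := ModuleCat.isScalarTower_of_algebra_moduleCat N.obj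
  have : Module.Finite B M.obj := M.property
  have : Module.Finite B N.obj := N.property
  have : Module.Finite k M.obj := Module.Finite.trans B M.obj
  have : Module.Finite k N.obj := Module.Finite.trans B N.obj
  let e : (M ⟶ N) →ₗ[k] (M.obj →ₗ[k] N.obj) :=
    { toFun := fun f => f.hom.hom.restrictScalars k
      map_add' := fun _ _ => rfl
      map_smul' := fun _ _ => by ext; rfl }
  refine Module.Finite.of_injective e ?_
  intro f g h
  ext x
  exact LinearMap.congr_fun h x

lemma hasFiniteBiproducts (k : Type w) [Field k] (C : Type u) [Category.{v} C] [Preadditive C]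
    [Linear k C] [IsFiniteLinear k C] : HasFiniteBiproducts C := by
  obtain ⟨B, _, _, _, F, _, _, _⟩ := IsFiniteLinear.exists_equivalence (k := k) (C := C)
  have : IsNoetherianRing B := IsNoetherianRing.of_finite k B
  have : HasFiniteProducts C :=
    ⟨fun n => Adjunction.hasLimitsOfShape_of_equivalence (J := Discrete (Fin n)) F⟩
  exact HasFiniteBiproducts.of_hasFiniteProducts

instance finite_hom (k : Type w) [Field k] {C : Type u} [Category.{v} C] [Preadditive C]
    [Linear k C] [IsFiniteLinear k C] (X Y : C) : Module.Finite k (X ⟶ Y) := by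
  obtain ⟨B, _, _, _, F, _, _, _⟩ := IsFiniteLinear.exists_equivalence (k := k) (C := C)
  have := fgModule_finite_hom k B (F.obj X) (F.obj Y)
  exact Module.Finite.of_injective (F.mapLinearMap k (X := X) (Y := Y)) F.map_injective

/-! ### The tensor product of a finite-dimensional vector space with an object -/

section Copower

variable (k : Type w) [Field k] {C : Type u} [Category.{v} C] [Preadditive C] [Linear k C]
  [IsFiniteLinear k C]

section

variable (V : Type*) [AddCommGroup V] [Module k V] (a : C)

/-- The object `V ⊗ a` of a finite `k`-linear category, for a finite-dimensional vector space `V`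
and an object `a`: the direct sum of `dim V` copies of `a`. It is characterised
by `Hom (V ⊗ a, y) ≅ Hom_k (V, Hom (a, y))`, see `copower_universal`. -/
def copower : C :=
  haveI := hasFiniteBiproducts k C
  ⨁ fun _ : Fin (Module.finrank k V) => a

variable [Module.Finite k V]

/-- The universal linear map `V → Hom (a, V ⊗ a)`. -/
def copowerι : V →ₗ[k] (a ⟶ copower k V a) :=
  haveI := hasFiniteBiproducts k C
  (Module.finBasis k V).constr k
    fun i => biproduct.ι (fun _ : Fin (Module.finrank k V) => a) i

variable {V a}

/-- The morphism `V ⊗ a ⟶ y` induced by a linear map `V → Hom (a, y)`. -/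
def copowerDesc {y : C} (φ : V →ₗ[k] (a ⟶ y)) : copower k V a ⟶ y :=
  haveI := hasFiniteBiproducts k C
  biproduct.desc fun i => φ (Module.finBasis k V i)

lemma copowerι_basis (i : Fin (Module.finrank k V)) :
    copowerι k V a (Module.finBasis k V i) =
      haveI := hasFiniteBiproducts k C
      biproduct.ι (fun _ : Fin (Module.finrank k V) => a) i :=
  (Module.finBasis k V).constr_basis k _ i

@[simp]
lemma copowerι_desc {y : C} (φ : V →ₗ[k] (a ⟶ y)) (x : V) :
    copowerι k V a x ≫ copowerDesc k φ = φ x := by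
  have := hasFiniteBiproducts k C
  suffices h : (Linear.rightComp k a (copowerDesc k φ)) ∘ₗ copowerι k V a = φ from
    LinearMap.congr_fun h x
  refine (Module.finBasis k V).ext fun i => ?_
  rw [LinearMap.comp_apply, Linear.rightComp_apply, copowerι_basis]
  exact biproduct.ι_desc (f := fun _ : Fin (Module.finrank k V) => a) _ _

lemma copower_hom_ext {y : C} {f g : copower k V a ⟶ y}
    (h : ∀ x, copowerι k V a x ≫ f = copowerι k V a x ≫ g) : f = g := by
  have := hasFiniteBiproducts k C
  refine biproduct.hom_ext' _ _ fun i => ?_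
  have hi := h (Module.finBasis k V i)
  rw [copowerι_basis] at hi
  exact hi

variable (V a) in
/-- The universal property of `V ⊗ a`. -/
lemma copower_universal {y : C} (φ : V →ₗ[k] (a ⟶ y)) :
    ∃! f : copower k V a ⟶ y, ∀ x, copowerι k V a x ≫ f = φ x :=
  ⟨copowerDesc k φ, copowerι_desc k φ, fun g hg =>
    copower_hom_ext k fun x => by rw [hg, copowerι_desc]⟩

end

section

variable {V W U : Type*} [AddCommGroup V] [Module k V] [Module.Finite k V]
  [AddCommGroup W] [Module k W] [Module.Finite k W]
  [AddCommGroup U] [Module k U] [Module.Finite k U]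

/-- The morphism `φ ⊗ f : V ⊗ a ⟶ W ⊗ b`, for a linear map `φ` and a morphism `f`. -/
def copowerMap {a b : C} (φ : V →ₗ[k] W) (f : a ⟶ b) : copower k V a ⟶ copower k W b :=
  copowerDesc k (Linear.leftComp k _ f ∘ₗ copowerι k W b ∘ₗ φ)

@[simp]
lemma copowerι_map {a b : C} (φ : V →ₗ[k] W) (f : a ⟶ b) (x : V) :
    copowerι k V a x ≫ copowerMap k φ f = f ≫ copowerι k W b (φ x) := by
  simp [copowerMap]

lemma copowerMap_id (a : C) {φ : V →ₗ[k] V} (hφ : φ = LinearMap.id) :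
    copowerMap k φ (𝟙 a) = 𝟙 _ :=
  copower_hom_ext k fun x => by simp [hφ]

lemma copowerMap_comp {a b c : C} {φ : V →ₗ[k] W} {ψ : W →ₗ[k] U} {χ : V →ₗ[k] U}
    {f : a ⟶ b} {g : b ⟶ c} {h : a ⟶ c} (hχ : χ = ψ ∘ₗ φ) (hh : h = f ≫ g) :
    copowerMap k χ h = copowerMap k φ f ≫ copowerMap k ψ g :=
  copower_hom_ext k fun x => by
    rw [← Category.assoc, copowerι_map, copowerι_map, Category.assoc, copowerι_map]
    simp [hχ, hh]

lemma copowerMap_comm {W' : Type*} [AddCommGroup W'] [Module k W'] [Module.Finite k W']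
    {a b b' c : C} {φ : V →ₗ[k] W} {ψ : W →ₗ[k] U} {φ' : V →ₗ[k] W'} {ψ' : W' →ₗ[k] U}
    {f : a ⟶ b} {g : b ⟶ c} {f' : a ⟶ b'} {g' : b' ⟶ c} (hφ : ψ ∘ₗ φ = ψ' ∘ₗ φ')
    (hf : f ≫ g = f' ≫ g') :
    copowerMap k φ f ≫ copowerMap k ψ g = copowerMap k φ' f' ≫ copowerMap k ψ' g' := by
  rw [← copowerMap_comp k rfl rfl, ← copowerMap_comp k rfl rfl, hφ, hf]

end

end Copower

/-! ### The Nakayama functors -/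

section Nakayama

variable (k : Type w) [Field k] {C : Type u} [Category.{v} C] [Preadditive C] [Linear k C]
  [IsFiniteLinear k C]

/-- The bifunctor `(b, a) ↦ Hom (b, x) ⊗ a`, contravariant in `b` and covariant in `a`. -/
def homTensor (x : C) : Cᵒᵖ ⥤ C ⥤ C where
  obj b :=
    { obj := fun a => copower k (b.unop ⟶ x) a
      map := fun f => copowerMap k LinearMap.id f
      map_id := fun _ => copowerMap_id k _ rfl
      map_comp := fun _ _ => copowerMap_comp k rfl rfl }
  map g :=
    { app := fun a => copowerMap k (Linear.leftComp k x g.unop) (𝟙 a)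
      naturality := fun _ _ _ => copowerMap_comm k rfl (by simp) }
  map_id b := NatTrans.ext <| funext fun a => copowerMap_id k a <| LinearMap.ext fun f => by
    exact Category.id_comp f
  map_comp f g := NatTrans.ext <| funext fun a => copowerMap_comp k
    (LinearMap.ext fun h => by exact Category.assoc g.unop f.unop h) (Category.id_comp (𝟙 a)).symm

/-- The bifunctor `(b, a) ↦ Hom (x, b)^* ⊗ a`, contravariant in `b` and covariant in `a`, where
`^*` is the linear dual. -/
def dualHomTensor (x : C) : Cᵒᵖ ⥤ C ⥤ C where
  obj b :=
    { obj := fun a => copower k (Module.Dual k (x ⟶ b.unop)) a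
      map := fun f => copowerMap k LinearMap.id f
      map_id := fun _ => copowerMap_id k _ rfl
      map_comp := fun _ _ => copowerMap_comp k rfl rfl }
  map g :=
    { app := fun a => copowerMap k (Linear.rightComp k x g.unop).dualMap (𝟙 a)
      naturality := fun _ _ _ => copowerMap_comm k rfl (by simp) }
  map_id b := NatTrans.ext <| funext fun a => copowerMap_id k a <|
    LinearMap.ext fun ξ => LinearMap.ext fun f => congrArg ξ (Category.comp_id f)
  map_comp f g := NatTrans.ext <| funext fun a => copowerMap_comp k
    (LinearMap.ext fun ξ => LinearMap.ext fun h =>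
      congrArg ξ (Category.assoc h g.unop f.unop).symm) (Category.id_comp (𝟙 a)).symm

/-- Functoriality of `Hom (b, x) ⊗ a` in `x`. -/
def homTensorMap {x y : C} (f : x ⟶ y) : homTensor k x ⟶ homTensor k y where
  app b :=
    { app := fun a => copowerMap k (Linear.rightComp k b.unop f) (𝟙 a)
      naturality := fun _ _ _ => copowerMap_comm k rfl (by simp) }
  naturality b b' g := NatTrans.ext <| funext fun a => copowerMap_comm k
    (LinearMap.ext fun h => Category.assoc g.unop h f) rfl

/-- Functoriality of `Hom (x, b)^* ⊗ a` in `x`. -/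
def dualHomTensorMap {x y : C} (f : x ⟶ y) : dualHomTensor k x ⟶ dualHomTensor k y where
  app b :=
    { app := fun a => copowerMap k (Linear.leftComp k b.unop f).dualMap (𝟙 a)
      naturality := fun _ _ _ => copowerMap_comm k rfl (by simp) }
  naturality b b' g := NatTrans.ext <| funext fun a => copowerMap_comm k
    (LinearMap.ext fun ξ => LinearMap.ext fun h =>
      congrArg ξ (Category.assoc f h g.unop)) rfl

variable (C)

/-- The left exact Nakayama functor `N^l (x) = ∫_a Hom (a, x) ⊗ a`, given that these ends
exist. -/
def nakayamaL [∀ x : C, HasEnd (homTensor k x)] : C ⥤ C where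
  obj x := end_ (homTensor k x)
  map f := end_.map (homTensorMap k f)
  map_id x := by
    have h : homTensorMap k (𝟙 x) = 𝟙 _ := NatTrans.ext <| funext fun b =>
      NatTrans.ext <| funext fun a => copowerMap_id k a <| LinearMap.ext fun f =>
        Category.comp_id f
    rw [h, end_.map_id]
  map_comp f g := by
    have h : homTensorMap k (f ≫ g) = homTensorMap k f ≫ homTensorMap k g :=
      NatTrans.ext <| funext fun b => NatTrans.ext <| funext fun a => copowerMap_comp k
        (LinearMap.ext fun h => (Category.assoc h f g).symm) (Category.id_comp (𝟙 a)).symm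
    rw [h, end_.map_comp]

/-- The right exact Nakayama functor `N^r (x) = ∫^a Hom (x, a)^* ⊗ a`, given that these coends
exist. -/
def nakayamaR [∀ x : C, HasCoend (dualHomTensor k x)] : C ⥤ C where
  obj x := coend (dualHomTensor k x)
  map f := coend.map (dualHomTensorMap k f)
  map_id x := by
    have h : dualHomTensorMap k (𝟙 x) = 𝟙 _ := NatTrans.ext <| funext fun b =>
      NatTrans.ext <| funext fun a => copowerMap_id k a <|
        LinearMap.ext fun ξ => LinearMap.ext fun f => congrArg ξ (Category.id_comp f)
    rw [h, coend.map_id]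
  map_comp f g := by
    have h : dualHomTensorMap k (f ≫ g) = dualHomTensorMap k f ≫ dualHomTensorMap k g :=
      NatTrans.ext <| funext fun b => NatTrans.ext <| funext fun a => copowerMap_comp k
        (LinearMap.ext fun ξ => LinearMap.ext fun h => congrArg ξ (Category.assoc f g h))
        (Category.id_comp (𝟙 a)).symm
    rw [h, coend.map_comp]

end Nakayama

/-! ### Duals -/

section Duals

variable (C : Type u) [Category.{v} C] [MonoidalCategory C]

/-- The double right dual functor `X ↦ X^∨∨`, where the right dual `X^∨` comes with
`X^∨ ⊗ X ⟶ 𝟙` and `𝟙 ⟶ X ⊗ X^∨`. -/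
def rightDoubleDual [RightRigidCategory C] : C ⥤ C where
  obj X := (Xᘁ)ᘁ
  map f := (fᘁ)ᘁ
  map_id X := by simp
  map_comp f g := by simp [comp_rightAdjointMate]

/-- The double left dual functor `X ↦ ^∨∨X`, where the left dual `^∨X` comes with
`X ⊗ ^∨X ⟶ 𝟙` and `𝟙 ⟶ ^∨X ⊗ X`. -/
def leftDoubleDual [LeftRigidCategory C] : C ⥤ C where
  obj X := ᘁ(ᘁX)
  map f := ᘁ(ᘁf)
  map_id X := by simp
  map_comp f g := by simp [comp_leftAdjointMate]

variable {C}

/-- `D` and `E` are mutually inverse objects for the tensor product. -/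
def IsTensorInverse (D E : C) : Prop :=
  Nonempty (D ⊗ E ≅ 𝟙_ C) ∧ Nonempty (E ⊗ D ≅ 𝟙_ C)

end Duals

end FiniteMultitensor

end

open FiniteMultitensor

/-!
A finite linear category has a regular generator `P`, the image of the regular module
(`exists_isRegularGenerator`). A cowedge `Hom (x, a)^* ⊗ a ⟶ n` is a natural family of linear maps
`Hom (x, a)^* → Hom (a, n)` (`DualFamily`). It is universal as soon as its component at `P` is
bijective, and then its component at every projective `z` is bijective
(`DualFamily.existsUnique_desc`, `DualFamily.bijective_of_projective`). So `N^r x` is the object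
whose `P`-points are `Hom (x, P)^*`, which proves that the coends exist
(`DualFamily.exists_bijective`).

Morphisms `N^r y ⟶ x` and wedges `y ⟶ Hom (a, x) ⊗ a` are two descriptions of
`∫_a Hom (y, a) ⊗ Hom (a, x)`. Hence any right adjoint of `N^r` computes the ends that define `N^l`
(`nonempty_isLimit_adjointWedge`).

Let `D = N^r 𝟙`. In the rigid category, `a ⊗ x^∨` and `^∨x ⊗ a` are projective if `a` is, so

  `Hom (P, D ⊗ x^∨∨) ≅ Hom (P ⊗ x^∨, D) ≅ Hom (𝟙, P ⊗ x^∨)^* ≅ Hom (x, P)^*`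

shows that `N^r ≅ D ⊗ (-)^∨∨`, and symmetrically `N^r ≅ ^∨∨(-) ⊗ D`
(`DualFamily.tensorDoubleDual`, `DualFamily.doubleDualTensor`).

Left duals of projective objects are projective, and this makes `D` invertible. Tensoring with `D`
is faithful, and for projective `z` the map `Hom (z, 𝟙) → Hom (D ⊗ z, D)` is bijective, because both
sides have the same dimension (`DualFamily.bijective_whiskerLeft`). For `z = P` this says that the
coevaluation `𝟙 ⟶ ^∨D ⊗ D` is an isomorphism. So `^∨D` is a left inverse, and the two formulas for
`N^r` turn it into a two-sided one (`DualFamily.isTensorInverse_leftDual`).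

As the double dual is a monoidal equivalence and fixes invertible objects, the right adjoints of
`D ⊗ (-)^∨∨` and of `^∨∨(-) ⊗ D` are `E ⊗ ^∨∨(-)` and `(-)^∨∨ ⊗ E` with `E` the inverse of `D`. Both
are `N^l`, so `E ≅ N^l 𝟙`, and comparing them at `x^∨∨` gives the formula for the quadruple dual.
-/

noncomputable section

namespace FiniteMultitensor

/-! ### Projective generators of finite linear categories -/

section Generator

variable (k : Type w) [Field k] {C : Type u} [Category.{v} C] [Preadditive C] [Linear k C]

/-- An object `P` of a `k`-linear category that plays the role of the regular module: it is
projective, and `Hom (P, -)` identifies the category with that of finite-dimensional vector spaces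
with a right action of `P ⟶ P` by precomposition. The last three fields express faithfulness,
fullness and essential surjectivity. -/
structure IsRegularGenerator (P : C) : Prop where
  projective : Projective P
  hom_ext : ∀ {a y : C} {f g : a ⟶ y}, (∀ p : P ⟶ a, p ≫ f = p ≫ g) → f = g
  exists_hom : ∀ {a y : C} (φ : (P ⟶ a) →ₗ[k] (P ⟶ y)),
    (∀ (e : P ⟶ P) (p : P ⟶ a), φ (e ≫ p) = e ≫ φ p) → ∃ f : a ⟶ y, ∀ p, φ p = p ≫ f
  exists_obj : ∀ (V : Type (max v w)) [AddCommGroup V] [Module k V] [Module.Finite k V]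
    (ρ : (P ⟶ P) →ₗ[k] (V →ₗ[k] V)), ρ (𝟙 P) = LinearMap.id →
    (∀ g h, ρ (g ≫ h) = ρ g ∘ₗ ρ h) →
    ∃ (n : C) (e : V ≃ₗ[k] (P ⟶ n)), ∀ g x, e (ρ g x) = g ≫ e x

lemma surjective_of_epi_fgModuleCat {B : Type w} [Ring B] {M N : FGModuleCat.{w} B} (f : M ⟶ N)
    [Epi f] : Function.Surjective f.hom.hom := by
  have : Module.Finite B N.obj := N.property
  let Q : FGModuleCat.{w} B := FGModuleCat.of B (N.obj ⧸ LinearMap.range f.hom.hom)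
  let q : N ⟶ Q := ⟨ModuleCat.ofHom (LinearMap.range f.hom.hom).mkQ⟩
  have h : q = 0 := by
    rw [← cancel_epi f, comp_zero]
    ext x
    exact (Submodule.Quotient.mk_eq_zero _).2 ⟨x, rfl⟩
  intro y
  have hy : q.hom.hom y = 0 := by rw [h]; rfl
  exact (Submodule.Quotient.mk_eq_zero _).1 hy

variable (C) in
/-- The object that corresponds to the regular module is a regular generator. -/
lemma exists_isRegularGenerator [IsFiniteLinear k C] : ∃ P : C, IsRegularGenerator k P := by
  obtain ⟨B, _, _, _, F, _, _, _⟩ := IsFiniteLinear.exists_equivalence (k := k) (C := C)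
  let P : C := F.objPreimage (FGModuleCat.of B B)
  let i : F.obj P ≅ FGModuleCat.of B B := F.objObjPreimageIso _
  let u : (F.obj P).obj := i.inv.hom.hom (1 : B)
  have hext {x : C} {p q : P ⟶ x} (h : (F.map p).hom.hom u = (F.map q).hom.hom u) : p = q := by
    apply F.map_injective
    rw [← cancel_epi i.inv]
    refine FGModuleCat.hom_ext (LinearMap.ext fun (b : B) => ?_)
    have hb : i.inv.hom.hom b = (b : B) • u := by
      rw [← map_smul, smul_eq_mul, mul_one]
    change (F.map p).hom.hom (i.inv.hom.hom b) = (F.map q).hom.hom (i.inv.hom.hom b)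
    rw [hb, map_smul, map_smul, h]
  have hsurj {x : C} (m : (F.obj x).obj) : ∃ p : P ⟶ x, (F.map p).hom.hom u = m := by
    let f : FGModuleCat.of B B ⟶ F.obj x := ⟨ModuleCat.ofHom (LinearMap.toSpanSingleton B _ m)⟩
    refine ⟨F.preimage (i.hom ≫ f), ?_⟩
    rw [F.map_preimage]
    change f.hom.hom ((i.inv ≫ i.hom).hom.hom (1 : B)) = m
    rw [i.inv_hom_id]
    exact one_smul B m
  -- the bijection `Hom (P, x) ≅ F x` given by evaluation at `u`
  let ev (x : C) : (P ⟶ x) ≃+ (F.obj x).obj :=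
    AddEquiv.ofBijective
      ({ toFun := fun p => (F.map p).hom.hom u
         map_zero' := by rw [F.map_zero]; rfl
         map_add' := fun p q => by rw [F.map_add]; rfl } : (P ⟶ x) →+ (F.obj x).obj)
      ⟨fun _ _ h => hext h, hsurj⟩
  have ev_comp {x y : C} (p : P ⟶ x) (f : x ⟶ y) :
      ev y (p ≫ f) = (F.map f).hom.hom (ev x p) := by
    change (F.map (p ≫ f)).hom.hom u = _
    rw [F.map_comp]; rfl
  have ev_smul {x : C} (c : k) (p : P ⟶ x) : ev x (c • p) = algebraMap k B c • ev x p := by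
    change (F.map (c • p)).hom.hom u = _
    rw [F.map_smul]; rfl
  -- `r b` is right multiplication by `b`
  let r (b : B) : P ⟶ P := (ev P).symm (b • u)
  have ev_r (b : B) : ev P (r b) = b • u := (ev P).apply_symm_apply _
  have ev_r_comp {x : C} (b : B) (p : P ⟶ x) : ev x (r b ≫ p) = b • ev x p := by
    rw [ev_comp, ev_r, map_smul]; rfl
  have ev_id : ev P (𝟙 P) = u := by
    change (F.map (𝟙 P)).hom.hom u = u
    rw [F.map_id]; rfl
  have r_surj (g : P ⟶ P) : ∃ b, r b = g := by
    refine ⟨i.hom.hom.hom (ev P g), (ev P).injective ?_⟩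
    rw [ev_r, ← map_smul, smul_eq_mul, mul_one]
    change (i.hom ≫ i.inv).hom.hom (ev P g) = ev P g
    rw [i.hom_inv_id]; rfl
  refine ⟨P, ⟨⟨fun {a y} p f _ => ?_⟩, fun {a y f g} h => ?_, fun {a y} φ hφ => ?_, ?_⟩⟩
  · obtain ⟨m, hm⟩ := surjective_of_epi_fgModuleCat (F.map f) (ev _ p)
    refine ⟨(ev _).symm m, (ev _).injective ?_⟩
    rw [ev_comp, AddEquiv.apply_symm_apply, hm]
  · apply F.map_injective
    ext m
    obtain ⟨p, rfl⟩ := (ev a).surjective m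
    rw [← ev_comp, ← ev_comp, h]
  · let ψ : (F.obj a).obj →ₗ[B] (F.obj y).obj :=
      { toFun := fun m => ev y (φ ((ev a).symm m))
        map_add' := fun m m' => by rw [map_add, map_add, map_add]
        map_smul' := fun b m => by
          have h : (ev a).symm (b • m) = r b ≫ (ev a).symm m := by
            rw [AddEquiv.symm_apply_eq, ev_r_comp, AddEquiv.apply_symm_apply]
          rw [h, hφ, ev_r_comp]; rfl }
    refine ⟨F.preimage ⟨ModuleCat.ofHom ψ⟩, fun p => (ev y).injective ?_⟩
    rw [ev_comp, F.map_preimage]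
    change _ = ev y (φ ((ev a).symm (ev a p)))
    rw [AddEquiv.symm_apply_apply]
  · intro V _ _ _ ρ hρ1 hρ
    let W := Fin (Module.finrank k V) → k
    let l : V ≃ₗ[k] W := (Module.finBasis k V).equivFun
    have r_one : r 1 = 𝟙 P := (ev P).injective (by rw [ev_r, ev_id, one_smul])
    have r_mul (b c : B) : r (b * c) = r b ≫ r c :=
      (ev P).injective (by rw [ev_r_comp, ev_r, ev_r, mul_smul])
    have r_add (b c : B) : r (b + c) = r b + r c :=
      (ev P).injective (by rw [map_add, ev_r, ev_r, ev_r, add_smul])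
    have r_alg (c : k) : r (algebraMap k B c) = c • 𝟙 P :=
      (ev P).injective (by rw [ev_r, ev_smul, ev_id])
    -- the `B`-module structure on `V`, carried by `k ^ n` to lie in the right universe
    let act : B →+* Module.End k W :=
      { toFun := fun b => l.conj (ρ (r b))
        map_one' := by rw [r_one, hρ1]; exact l.conj_id
        map_mul' := fun b c => by rw [r_mul, hρ]; exact l.conj_comp _ _
        map_zero' := by
          have : r 0 = 0 := (ev P).injective (by rw [ev_r, zero_smul, map_zero])
          rw [this, map_zero, map_zero]
        map_add' := fun b c => by rw [r_add, map_add, map_add] }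
    let mB : Module B W := Module.compHom W act
    have smul_def (b : B) (x : W) : b • x = l (ρ (r b) (l.symm x)) := rfl
    have alg_smul (c : k) (x : W) : algebraMap k B c • x = c • x := by
      rw [smul_def, r_alg, map_smul, hρ1, LinearMap.smul_apply, LinearMap.id_apply, map_smul,
        LinearEquiv.apply_symm_apply]
    have tower : IsScalarTower k B W := ⟨fun c b x => by
      rw [Algebra.smul_def, mul_smul, alg_smul]⟩
    have fin : Module.Finite B W := Module.Finite.of_restrictScalars_finite k B W
    let n : C := F.objPreimage (FGModuleCat.of B W)
    let j : F.obj n ≅ FGModuleCat.of B W := F.objObjPreimageIso _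
    let J : (F.obj n).obj ≃ₗ[B] W := FGModuleCat.isoToLinearEquiv j
    let e : V ≃+ (P ⟶ n) := l.toAddEquiv.trans (J.symm.toAddEquiv.trans (ev n).symm)
    have ev_e (x : V) : ev n (e x) = J.symm (l x) := (ev n).apply_symm_apply _
    refine ⟨n, { e with map_smul' := fun c x => (ev n).injective ?_ },
      fun g x => (ev n).injective ?_⟩
    · change ev n (e (c • x)) = ev n (c • e x)
      rw [ev_smul, ev_e, ev_e, ← map_smul, alg_smul, map_smul]
    · obtain ⟨b, rfl⟩ := r_surj g
      change ev n (e (ρ (r b) x)) = ev n (r b ≫ e x)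
      rw [ev_r_comp, ev_e, ev_e, ← map_smul, smul_def, LinearEquiv.symm_apply_apply]

end Generator

/-! ### Cowedges as families of linear maps -/

section DualFamily

variable (k : Type w) [Field k] {C : Type u} [Category.{v} C] [Preadditive C] [Linear k C]

/-- A family of linear maps `Hom (x, a)^* → Hom (a, n)`, natural in `a`. Such families correspond
to the cowedges `Hom (x, a)^* ⊗ a ⟶ n`. -/
structure DualFamily (x n : C) where
  /-- The component at `a`. -/
  ι (a : C) : Module.Dual k (x ⟶ a) →ₗ[k] (a ⟶ n)
  comp_ι {a b : C} (g : a ⟶ b) (ξ : Module.Dual k (x ⟶ b)) :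
    g ≫ ι b ξ = ι a (ξ ∘ₗ Linear.rightComp k x g)

variable {k}

namespace DualFamily

variable {P : C} {x n : C}

/-- A family which is bijective at a regular generator is universal. -/
lemma existsUnique_desc (hP : IsRegularGenerator k P) (d : DualFamily k x n)
    (hd : Function.Bijective (d.ι P)) {y : C} (d' : DualFamily k x y) :
    ∃! f : n ⟶ y, ∀ a ξ, d.ι a ξ ≫ f = d'.ι a ξ := by
  let e := LinearEquiv.ofBijective (d.ι P) hd
  have he (g : P ⟶ P) (p : P ⟶ n) : e.symm (g ≫ p) = e.symm p ∘ₗ Linear.rightComp k x g := by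
    rw [LinearEquiv.symm_apply_eq, LinearEquiv.ofBijective_apply, ← d.comp_ι]
    exact congrArg (g ≫ ·) (e.apply_symm_apply p).symm
  obtain ⟨f, hf⟩ := hP.exists_hom (d'.ι P ∘ₗ e.symm.toLinearMap) fun g p => by
    simp [he, d'.comp_ι]
  have hf' (ξ : Module.Dual k (x ⟶ P)) : d.ι P ξ ≫ f = d'.ι P ξ := by
    rw [← hf]
    exact congrArg (d'.ι P) (e.symm_apply_apply ξ)
  refine ⟨f, fun a ξ => hP.hom_ext fun p => ?_, fun g hg => hP.hom_ext fun p => ?_⟩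
  · rw [← Category.assoc, d.comp_ι, d'.comp_ι, hf']
  · obtain ⟨ξ, rfl⟩ := hd.2 p
    rw [hf', hg]

variable (x) in
/-- The coend of `Hom (x, a)^* ⊗ a` is the object whose maps from a regular generator `P` form the
`P ⟶ P`-module `Hom (x, P)^*`. -/
lemma exists_bijective [IsFiniteLinear k C] (hP : IsRegularGenerator k P) :
    ∃ (n : C) (d : DualFamily k x n), Function.Bijective (d.ι P) := by
  obtain ⟨n, e, he⟩ := hP.exists_obj (Module.Dual k (x ⟶ P))
    { toFun := fun g => (Linear.rightComp k x g).dualMap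
      map_add' := fun g h => by ext ξ p; simp
      map_smul' := fun c g => by ext ξ p; simp } (by ext ξ p; simp) (fun g h => by ext ξ p; simp)
  change ∀ (g : P ⟶ P) (ξ : Module.Dual k (x ⟶ P)), e (ξ ∘ₗ Linear.rightComp k x g) = g ≫ e ξ at he
  -- the component at `a` is the morphism that corresponds to `p ↦ e (ξ ∘ p_*)`
  have key (a : C) (ξ : Module.Dual k (x ⟶ a)) :
      ∃ f : a ⟶ n, ∀ p : P ⟶ a, e (ξ ∘ₗ Linear.rightComp k x p) = p ≫ f := by
    obtain ⟨f, hf⟩ := hP.exists_hom (a := a) (y := n)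
      { toFun := fun p => e (ξ ∘ₗ Linear.rightComp k x p)
        map_add' := fun p q => by rw [← map_add]; congr 1; ext; simp
        map_smul' := fun c p => by
          rw [RingHom.id_apply, ← map_smul]; congr 1; ext; simp } fun g p => by
        change e _ = g ≫ e _
        rw [← he]; congr 1; ext; simp
    exact ⟨f, hf⟩
  choose f hf using key
  refine ⟨n, ⟨fun a => ⟨⟨f a, fun ξ ξ' => hP.hom_ext fun p => ?_⟩,
    fun c ξ => hP.hom_ext fun p => ?_⟩, fun {a b} g ξ => hP.hom_ext fun p => ?_⟩, ?_⟩
  · rw [Preadditive.comp_add, ← hf, ← hf, ← hf, LinearMap.add_comp, map_add]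
  · rw [RingHom.id_apply, Linear.comp_smul, ← hf]
    rw [LinearMap.smul_comp, map_smul]
    exact congrArg (c • ·) (hf a ξ p)
  · change p ≫ g ≫ f b ξ = p ≫ f a _
    rw [← Category.assoc, ← hf, ← hf]
    congr 1; ext; simp
  · have : ∀ ξ, f P ξ = e ξ := fun ξ => by
      have h := hf P ξ (𝟙 P)
      rw [Category.id_comp] at h
      rw [← h]; congr 1; ext; simp
    change Function.Bijective (f P)
    rw [funext this]
    exact e.bijective

end DualFamily

/-- A projective object is a direct summand of a direct sum of copies of a regular generator. -/
lemma IsRegularGenerator.exists_retract [IsFiniteLinear k C] {P : C}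
    (hP : IsRegularGenerator k P) (z : C) [Projective z] :
    ∃ (m : ℕ) (s : Fin m → (z ⟶ P)) (p : Fin m → (P ⟶ z)), ∑ i, s i ≫ p i = 𝟙 z := by
  have := hasFiniteBiproducts k C
  let b := Module.finBasis k (P ⟶ z)
  let q : (⨁ fun _ : Fin (Module.finrank k (P ⟶ z)) => P) ⟶ z := biproduct.desc b
  have hq : Epi q := ⟨fun g h hgh => hP.hom_ext fun p => by
    have hb : (Linear.rightComp k P g) = Linear.rightComp k P h := b.ext fun i => by
      have := biproduct.ι (fun _ => P) i ≫= hgh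
      rwa [← Category.assoc, ← Category.assoc, biproduct.ι_desc] at this
    exact LinearMap.congr_fun hb p⟩
  refine ⟨_, fun i => Projective.factorThru (𝟙 z) q ≫ biproduct.π _ i, b, ?_⟩
  have h : (∑ i, biproduct.π (fun _ => P) i ≫ b i) = q := by
    refine biproduct.hom_ext' _ _ fun i => ?_
    rw [Preadditive.comp_sum, Finset.sum_eq_single i, ← Category.assoc, biproduct.ι_π_self,
      Category.id_comp, biproduct.ι_desc]
    · intro j _ hj
      rw [← Category.assoc, biproduct.ι_π_ne _ hj.symm, zero_comp]
    · simp
  simp only [Category.assoc]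
  rw [← Preadditive.comp_sum, h, Projective.factorThru_comp]

lemma IsRegularGenerator.isIso_of_bijective {P : C} (hP : IsRegularGenerator k P) {x y : C}
    (f : x ⟶ y) (hf : Function.Bijective fun p : P ⟶ x => p ≫ f) : IsIso f := by
  let e := LinearEquiv.ofBijective (Linear.rightComp k P f) hf
  have he (p : P ⟶ y) : e.symm p ≫ f = p := e.apply_symm_apply p
  obtain ⟨g, hg⟩ := hP.exists_hom e.symm.toLinearMap fun q p => hf.1 (by
    change e.symm (q ≫ p) ≫ f = (q ≫ e.symm p) ≫ f
    rw [he, Category.assoc, he])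
  have hg' (p : P ⟶ y) : (p ≫ g) ≫ f = p := by rw [← hg]; exact he p
  refine ⟨g, hP.hom_ext fun p => hf.1 ?_, hP.hom_ext fun p => ?_⟩
  · change (p ≫ f ≫ g) ≫ f = (p ≫ 𝟙 x) ≫ f
    rw [← Category.assoc p, hg', Category.comp_id]
  · rw [← Category.assoc, hg', Category.comp_id]

lemma DualFamily.bijective_of_projective [IsFiniteLinear k C] {P x n : C}
    (hP : IsRegularGenerator k P) (d : DualFamily k x n) (hd : Function.Bijective (d.ι P))
    (z : C) [Projective z] : Function.Bijective (d.ι z) := by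
  obtain ⟨m, s, p, hsp⟩ := hP.exists_retract z
  constructor
  · refine (injective_iff_map_eq_zero (d.ι z)).2 fun ξ hξ => ?_
    have h0 (i : Fin m) : ξ ∘ₗ Linear.rightComp k x (p i) = 0 := hd.1 <| by
      rw [← d.comp_ι, hξ, map_zero, comp_zero]
    ext f
    have : f = ∑ i, (f ≫ s i) ≫ p i := by
      simp only [Category.assoc]
      rw [← Preadditive.comp_sum, hsp, Category.comp_id]
    rw [this, map_sum]
    exact Finset.sum_eq_zero fun i _ => LinearMap.congr_fun (h0 i) (f ≫ s i)
  · intro f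
    choose ξ hξ using fun i => hd.2 (p i ≫ f)
    refine ⟨∑ i, ξ i ∘ₗ Linear.rightComp k x (s i), ?_⟩
    rw [map_sum]
    calc ∑ i, d.ι z (ξ i ∘ₗ Linear.rightComp k x (s i)) = ∑ i, s i ≫ p i ≫ f := by
          refine Finset.sum_congr rfl fun i _ => ?_
          rw [← d.comp_ι, hξ]
      _ = f := by
          simp only [← Category.assoc]
          rw [← Preadditive.sum_comp, hsp, Category.id_comp]

lemma DualFamily.finrank_hom_eq [IsFiniteLinear k C] {P x n : C}
    (hP : IsRegularGenerator k P) (d : DualFamily k x n) (hd : Function.Bijective (d.ι P))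
    (z : C) [Projective z] : Module.finrank k (z ⟶ n) = Module.finrank k (x ⟶ z) := by
  rw [← Subspace.dual_finrank_eq (K := k) (V := x ⟶ z)]
  exact (LinearEquiv.ofBijective _ (d.bijective_of_projective hP hd z)).finrank_eq.symm

end DualFamily

/-! ### The right exact Nakayama functor -/

section NakayamaR

variable (k : Type w) [Field k] {C : Type u} [Category.{v} C] [Preadditive C] [Linear k C]
  [IsFiniteLinear k C]

/-- The cowedge that corresponds to a family of linear maps `Hom (x, a)^* → Hom (a, n)`. -/
def DualFamily.cowedge {x n : C} (d : DualFamily k x n) : Cowedge (dualHomTensor k x) :=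
  Cowedge.mk n (fun a => copowerDesc k (d.ι a)) fun a b g => copower_hom_ext k fun ξ => by
    change copowerι k _ a ξ ≫ copowerMap k (Linear.rightComp k x g).dualMap (𝟙 a) ≫ _ =
      copowerι k _ a ξ ≫ copowerMap k LinearMap.id g ≫ _
    rw [← Category.assoc, ← Category.assoc, copowerι_map, copowerι_map, Category.id_comp,
      Category.assoc, copowerι_desc, copowerι_desc]
    exact (d.comp_ι g ξ).symm

variable {k} in
lemma copowerι_comp_dualMap {x y i a : C} (g : i ⟶ a) (h : copower k (Module.Dual k (x ⟶ i)) i ⟶ y)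
    (ξ : Module.Dual k (x ⟶ a)) :
    copowerι k _ i ξ ≫ copowerMap k (Linear.rightComp k x g).dualMap (𝟙 i) ≫ h =
      copowerι k _ i (ξ ∘ₗ Linear.rightComp k x g) ≫ h := by
  rw [← Category.assoc, copowerι_map, Category.id_comp]
  rfl

variable {k} in
lemma copowerι_comp_map_id {V : Type*} [AddCommGroup V] [Module k V] [Module.Finite k V]
    {i a y : C} (g : i ⟶ a) (h : copower k V a ⟶ y) (ξ : V) :
    copowerι k V i ξ ≫ copowerMap k LinearMap.id g ≫ h = g ≫ copowerι k V a ξ ≫ h := by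
  rw [← Category.assoc, copowerι_map, Category.assoc]
  rfl

variable {k} in
lemma copowerι_desc_comp {V : Type*} [AddCommGroup V] [Module k V] [Module.Finite k V]
    {a y z : C} (φ : V →ₗ[k] (a ⟶ y)) (h : y ⟶ z) (ξ : V) :
    copowerι k V a ξ ≫ copowerDesc k φ ≫ h = φ ξ ≫ h := by
  rw [← Category.assoc, copowerι_desc]

/-- The family of linear maps `Hom (x, a)^* → Hom (a, n)` that corresponds to a cowedge. -/
def DualFamily.ofCowedge {x : C} (E : Cowedge (dualHomTensor k x)) : DualFamily k x E.pt where
  ι a := Linear.rightComp k a (E.π a) ∘ₗ copowerι k (Module.Dual k (x ⟶ a)) a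
  comp_ι {a b} g ξ :=
    ((copowerι_comp_map_id g (E.π b) ξ).symm.trans
      (congrArg (copowerι k _ a ξ ≫ ·) (E.condition g).symm)).trans
      (copowerι_comp_dualMap g (E.π a) ξ)

variable {k}

lemma DualFamily.nonempty_isColimit {P x n : C} (hP : IsRegularGenerator k P)
    (d : DualFamily k x n) (hd : Function.Bijective (d.ι P)) : Nonempty (IsColimit d.cowedge) := by
  choose f hf hf' using fun E : Cowedge (dualHomTensor k x) =>
    d.existsUnique_desc hP hd (DualFamily.ofCowedge k E)
  refine ⟨Multicofork.IsColimit.mk _ f (fun E (a : C) => ?_)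
    fun E m hm => hf' E m fun a ξ => ?_⟩
  · exact copower_hom_ext k fun ξ => (copowerι_desc_comp (d.ι a) (f E) ξ).trans (hf E a ξ)
  · exact (copowerι_desc_comp (d.ι a) m ξ).symm.trans (congrArg (copowerι k _ a ξ ≫ ·) (hm a))

/-- The coends that define `N^r` exist in a finite linear category. -/
lemma hasCoend_dualHomTensor (x : C) : HasCoend (dualHomTensor k x) := by
  obtain ⟨P, hP⟩ := exists_isRegularGenerator k C
  obtain ⟨n, d, hd⟩ := DualFamily.exists_bijective x hP
  obtain ⟨h⟩ := d.nonempty_isColimit hP hd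
  exact ⟨⟨_, h⟩⟩

/-- A functor with families `Hom (x, a)^* → Hom (a, N x)`, natural in `x` and bijective at a
regular generator, is the right exact Nakayama functor. -/
lemma nonempty_nakayamaR_iso [∀ x : C, HasCoend (dualHomTensor k x)] {P : C}
    (hP : IsRegularGenerator k P) (N : C ⥤ C) (d : ∀ x, DualFamily k x (N.obj x))
    (hd : ∀ x, Function.Bijective ((d x).ι P))
    (hN : ∀ {x y : C} (f : x ⟶ y) (a : C) (ξ : Module.Dual k (x ⟶ a)),
      (d x).ι a ξ ≫ N.map f = (d y).ι a (ξ ∘ₗ Linear.leftComp k a f)) :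
    Nonempty (nakayamaR k C ≅ N) := by
  have h (x : C) := ((d x).nonempty_isColimit hP (hd x)).some
  let e (x : C) : coend (dualHomTensor k x) ≅ N.obj x :=
    (colimit.isColimit _).coconePointUniqueUpToIso (h x)
  have he (x a : C) : coend.ι (dualHomTensor k x) a ≫ (e x).hom = copowerDesc k ((d x).ι a) :=
    IsColimit.comp_coconePointUniqueUpToIso_hom (colimit.isColimit _) (h x) (.right a)
  have nat {x y : C} (f : x ⟶ y) :
      coend.map (dualHomTensorMap k f) ≫ (e y).hom = (e x).hom ≫ N.map f := by
    refine coend.hom_ext fun a => ?_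
    rw [← Category.assoc, ← Category.assoc, coend.ι_map, Category.assoc, he, he]
    refine copower_hom_ext k fun ξ => ?_
    change copowerι k (Module.Dual k (x ⟶ a)) a ξ ≫
      copowerMap k (Linear.leftComp k a f).dualMap (𝟙 a) ≫ copowerDesc k ((d y).ι a) =
        copowerι k (Module.Dual k (x ⟶ a)) a ξ ≫ copowerDesc k ((d x).ι a) ≫ N.map f
    rw [copowerι_desc_comp, hN, ← Category.assoc, copowerι_map, Category.id_comp, copowerι_desc]
    rfl
  exact ⟨NatIso.ofComponents e nat⟩

end NakayamaR

/-! ### The left exact Nakayama functor -/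

section NakayamaL

variable {k : Type w} [Field k] {C : Type u} [Category.{v} C] [Preadditive C] [Linear k C]
  [IsFiniteLinear k C]

/-- The morphism `V ⊗ a ⟶ a` given by a linear form on `V`. -/
def copowerEval {V : Type*} [AddCommGroup V] [Module k V] [Module.Finite k V] {a : C}
    (ξ : Module.Dual k V) : copower k V a ⟶ a :=
  copowerDesc k (ξ.smulRight (𝟙 a))

lemma copowerι_eval {V : Type*} [AddCommGroup V] [Module k V] [Module.Finite k V] {a : C}
    (ξ : Module.Dual k V) (x : V) : copowerι k V a x ≫ copowerEval ξ = ξ x • 𝟙 a := by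
  simp [copowerEval]

variable (k) in
/-- `copowerEval` as a linear map. -/
def copowerEvalₗ (V : Type*) [AddCommGroup V] [Module k V] [Module.Finite k V] (a : C) :
    Module.Dual k V →ₗ[k] (copower k V a ⟶ a) where
  toFun := copowerEval
  map_add' η η' := copower_hom_ext k fun ξ => by
    rw [Preadditive.comp_add, copowerι_eval, copowerι_eval, copowerι_eval,
      LinearMap.add_apply, add_smul]
  map_smul' c η := copower_hom_ext k fun ξ => by
    rw [RingHom.id_apply, Linear.comp_smul, copowerι_eval, copowerι_eval,
      LinearMap.smul_apply, smul_assoc]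

lemma copowerMap_eval {V W : Type*} [AddCommGroup V] [Module k V] [Module.Finite k V]
    [AddCommGroup W] [Module k W] [Module.Finite k W] {a b : C} (φ : V →ₗ[k] W) (f : a ⟶ b)
    (ξ : Module.Dual k W) :
    copowerMap k φ f ≫ copowerEval ξ = copowerEval (ξ ∘ₗ φ) ≫ f :=
  copower_hom_ext k fun x => by
    rw [← Category.assoc, copowerι_map, Category.assoc, copowerι_eval, ← Category.assoc,
      copowerι_eval, Linear.comp_smul, Linear.smul_comp, Category.comp_id, Category.id_comp]
    rfl

lemma sum_copowerEval {V : Type*} [AddCommGroup V] [Module k V] [Module.Finite k V] (a : C) :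
    ∑ i, copowerEval ((Module.finBasis k V).coord i) ≫
      copowerι k V a (Module.finBasis k V i) = 𝟙 (copower k V a) :=
  copower_hom_ext k fun x => by
    rw [Preadditive.comp_sum]
    simp_rw [← Category.assoc, copowerι_eval, Linear.smul_comp, Category.id_comp, ← map_smul]
    rw [← map_sum, Category.comp_id]
    exact congrArg _ ((Module.finBasis k V).sum_repr x)

lemma copower_hom_ext' {V : Type*} [AddCommGroup V] [Module k V] [Module.Finite k V] {a y : C}
    {f g : y ⟶ copower k V a}
    (h : ∀ ξ : Module.Dual k V, f ≫ copowerEval ξ = g ≫ copowerEval ξ) : f = g := by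
  rw [← Category.comp_id f, ← Category.comp_id g, ← sum_copowerEval a, Preadditive.comp_sum,
    Preadditive.comp_sum]
  exact Finset.sum_congr rfl fun i _ => by rw [← Category.assoc, h, Category.assoc]

/-- `V ⊗ a` is also the cotensor of `a` by `V^*`: a linear map `V^* → Hom (y, a)` induces a
morphism `y ⟶ V ⊗ a`. -/
def copowerLift {V : Type*} [AddCommGroup V] [Module k V] [Module.Finite k V] {a y : C}
    (φ : Module.Dual k V →ₗ[k] (y ⟶ a)) : y ⟶ copower k V a :=
  ∑ i, φ ((Module.finBasis k V).coord i) ≫ copowerι k V a (Module.finBasis k V i)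

lemma copowerLift_eval {V : Type*} [AddCommGroup V] [Module k V] [Module.Finite k V] {a y : C}
    (φ : Module.Dual k V →ₗ[k] (y ⟶ a)) (ξ : Module.Dual k V) :
    copowerLift φ ≫ copowerEval ξ = φ ξ := by
  simp_rw [copowerLift, Preadditive.sum_comp, Category.assoc, copowerι_eval, Linear.comp_smul,
    Category.comp_id, ← map_smul]
  rw [← map_sum]
  congr 1
  refine (Module.finBasis k V).ext fun j => ?_
  simp

lemma eq_of_forall_dual {V : Type*} [AddCommGroup V] [Module k V] {x y : V}
    (h : ∀ ξ : Module.Dual k V, ξ x = ξ y) : x = y :=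
  Module.eval_apply_injective k (LinearMap.ext h)

/-- A morphism `n ⟶ x` out of the vertex of a family `Hom (y, a)^* → Hom (a, n)` gives a family
`Hom (a, x)^* → Hom (y, a)`; both describe an element of `∫_a Hom (y, a) ⊗ Hom (a, x)`. -/
def DualFamily.transpose {y n x : C} (d : DualFamily k y n) (f : n ⟶ x) (a : C) :
    Module.Dual k (a ⟶ x) →ₗ[k] (y ⟶ a) :=
  (Module.evalEquiv k (y ⟶ a)).symm.toLinearMap ∘ₗ
    (Linear.rightComp k a f ∘ₗ d.ι a).dualMap

lemma DualFamily.apply_transpose {y n x : C} (d : DualFamily k y n) (f : n ⟶ x) (a : C)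
    (η : Module.Dual k (a ⟶ x)) (ξ : Module.Dual k (y ⟶ a)) :
    ξ (d.transpose f a η) = η (d.ι a ξ ≫ f) :=
  Module.apply_evalEquiv_symm_apply k (y ⟶ a) ξ _

lemma DualFamily.transpose_comp {y n x : C} (d : DualFamily k y n) (f : n ⟶ x) {a b : C}
    (g : a ⟶ b) (η : Module.Dual k (a ⟶ x)) :
    d.transpose f a η ≫ g = d.transpose f b (η ∘ₗ Linear.leftComp k x g) := by
  refine eq_of_forall_dual (k := k) fun ξ => ?_
  rw [d.apply_transpose]
  change (ξ ∘ₗ Linear.rightComp k y g) (d.transpose f a η) = η (g ≫ d.ι b ξ ≫ f)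
  rw [d.apply_transpose, ← d.comp_ι, Category.assoc]

/-- Every natural family `Hom (a, x)^* → Hom (y, a)` is the transpose of a unique morphism out of
a universal family. -/
lemma DualFamily.existsUnique_transpose {P y n x : C} (hP : IsRegularGenerator k P)
    (d : DualFamily k y n) (hd : Function.Bijective (d.ι P))
    (t : ∀ a, Module.Dual k (a ⟶ x) →ₗ[k] (y ⟶ a))
    (ht : ∀ {a b : C} (g : a ⟶ b) (η : Module.Dual k (a ⟶ x)),
      t a η ≫ g = t b (η ∘ₗ Linear.leftComp k x g)) :
    ∃! f : n ⟶ x, ∀ a η, d.transpose f a η = t a η := by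
  let d' : DualFamily k y x :=
    { ι := fun a => (Module.evalEquiv k (a ⟶ x)).symm.toLinearMap ∘ₗ (t a).dualMap
      comp_ι := fun {a b} g ξ => eq_of_forall_dual (k := k) fun η => by
        have h := Module.apply_evalEquiv_symm_apply k (b ⟶ x) (η ∘ₗ Linear.leftComp k x g)
          ((t b).dualMap ξ)
        refine h.trans ?_
        refine Eq.trans ?_ (Module.apply_evalEquiv_symm_apply k (a ⟶ x) η
          ((t a).dualMap (ξ ∘ₗ Linear.rightComp k y g))).symm
        exact congrArg ξ (ht g η).symm }
  have hd' (a : C) (ξ : Module.Dual k (y ⟶ a)) (η : Module.Dual k (a ⟶ x)) :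
      η (d'.ι a ξ) = ξ (t a η) :=
    Module.apply_evalEquiv_symm_apply k (a ⟶ x) η _
  obtain ⟨f, hf, hf'⟩ := d.existsUnique_desc hP hd d'
  refine ⟨f, fun a η => eq_of_forall_dual (k := k) fun ξ => ?_, fun g hg => hf' g fun a ξ =>
    eq_of_forall_dual (k := k) fun η => ?_⟩
  · rw [d.apply_transpose, hf, hd']
  · rw [hd', ← hg, d.apply_transpose]

/-- The wedge that corresponds to a natural family `Hom (a, x)^* → Hom (y, a)`. -/
def wedgeOfFamily {x y : C} (t : ∀ a, Module.Dual k (a ⟶ x) →ₗ[k] (y ⟶ a))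
    (ht : ∀ {a b : C} (g : a ⟶ b) (η : Module.Dual k (a ⟶ x)),
      t a η ≫ g = t b (η ∘ₗ Linear.leftComp k x g)) : Wedge (homTensor k x) :=
  Wedge.mk y (fun a => copowerLift (t a)) fun a b g => copower_hom_ext' fun η => by
    change (copowerLift (t a) ≫ copowerMap k LinearMap.id g) ≫ copowerEval η =
      (copowerLift (t b) ≫ copowerMap k (Linear.leftComp k x g) (𝟙 b)) ≫ copowerEval η
    rw [Category.assoc, Category.assoc, copowerMap_eval, copowerMap_eval, Category.comp_id,
      ← Category.assoc, copowerLift_eval, copowerLift_eval, ← ht, LinearMap.comp_id]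

/-- The family `Hom (a, x)^* → Hom (y, a)` that corresponds to a wedge. -/
def familyOfWedge {x : C} (E : Wedge (homTensor k x)) (a : C) :
    Module.Dual k (a ⟶ x) →ₗ[k] (E.pt ⟶ a) :=
  Linear.leftComp k a (E.ι a) ∘ₗ copowerEvalₗ k (a ⟶ x) a

lemma familyOfWedge_comp {x : C} (E : Wedge (homTensor k x)) {a b : C} (g : a ⟶ b)
    (η : Module.Dual k (a ⟶ x)) :
    familyOfWedge E a η ≫ g = familyOfWedge E b (η ∘ₗ Linear.leftComp k x g) := by
  have h1 (e : E.pt ⟶ copower k (a ⟶ x) a) : (e ≫ copowerEval η) ≫ g =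
      (e ≫ copowerMap k LinearMap.id g) ≫ copowerEval η := by
    rw [Category.assoc, Category.assoc, copowerMap_eval, LinearMap.comp_id]
  have h2 (e : E.pt ⟶ copower k (b ⟶ x) b) :
      (e ≫ copowerMap k (Linear.leftComp k x g) (𝟙 b)) ≫ copowerEval η =
      e ≫ copowerEval (η ∘ₗ Linear.leftComp k x g) := by
    rw [Category.assoc, copowerMap_eval, Category.comp_id]
  exact ((h1 (E.ι a)).trans (congrArg (· ≫ copowerEval η) (E.condition g))).trans (h2 (E.ι b))

variable {P : C} (hP : IsRegularGenerator k P) {N R : C ⥤ C} (adj : N ⊣ R)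
  (d : ∀ x, DualFamily k x (N.obj x))

/-- For a right adjoint `R` of a functor `N` with families `Hom (x, a)^* → Hom (a, N x)`, the wedge
with vertex `R x` given by the transpose of the counit. -/
def adjointWedge (x : C) : Wedge (homTensor k x) :=
  wedgeOfFamily (fun a => (d (R.obj x)).transpose (adj.counit.app x) a)
    ((d (R.obj x)).transpose_comp _)

variable (hd : ∀ x, Function.Bijective ((d x).ι P))
  (hN : ∀ {x y : C} (f : x ⟶ y) (a : C) (ξ : Module.Dual k (x ⟶ a)),
    (d x).ι a ξ ≫ N.map f = (d y).ι a (ξ ∘ₗ Linear.leftComp k a f))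

include hN in
lemma comp_transpose {y y' x : C} (h : y' ⟶ y) (f : N.obj y ⟶ x) (a : C)
    (η : Module.Dual k (a ⟶ x)) :
    h ≫ (d y).transpose f a η = (d y').transpose (N.map h ≫ f) a η := by
  refine eq_of_forall_dual (k := k) fun ξ => ?_
  rw [(d y').apply_transpose, ← Category.assoc, hN]
  exact (d y).apply_transpose f a η (ξ ∘ₗ Linear.leftComp k a h)

include hP hd hN in
/-- Since `N` is the coend functor, `R` computes the end `∫_a Hom (a, x) ⊗ a`. -/
lemma nonempty_isLimit_adjointWedge (x : C) : Nonempty (IsLimit (adjointWedge adj d x)) := by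
  choose f hf hf' using fun E : Wedge (homTensor k x) =>
    (d E.pt).existsUnique_transpose hP (hd E.pt) (familyOfWedge E) (familyOfWedge_comp E)
  have key (E : Wedge (homTensor k x)) (h : E.pt ⟶ R.obj x) (a : C) (η : Module.Dual k (a ⟶ x)) :
      (h ≫ copowerLift ((d (R.obj x)).transpose (adj.counit.app x) a)) ≫ copowerEval η =
        (d E.pt).transpose ((adj.homEquiv _ _).symm h) a η := by
    rw [Category.assoc, copowerLift_eval, comp_transpose d hN, adj.homEquiv_counit]
  refine ⟨Multifork.IsLimit.mk _ (fun E => adj.homEquiv _ _ (f E)) (fun E (a : C) => ?_)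
    fun E m hm => ?_⟩
  · refine copower_hom_ext' fun η => (key E _ a η).trans ?_
    rw [Equiv.symm_apply_apply]
    exact hf E a η
  · refine ((adj.homEquiv _ _).symm_apply_eq).1 (hf' E _ fun a η => (key E m a η).symm.trans ?_)
    exact congrArg (· ≫ copowerEval η) (hm a)

include hP hd hN adj in
lemma hasEnd_homTensor (x : C) : HasEnd (homTensor k x) :=
  ⟨⟨_, (nonempty_isLimit_adjointWedge hP adj d hd hN x).some⟩⟩

include hP hd hN adj in
/-- The left exact Nakayama functor is the right adjoint of the right exact one. -/
lemma nonempty_nakayamaL_iso [∀ x : C, HasEnd (homTensor k x)] :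
    Nonempty (nakayamaL k C ≅ R) := by
  have h (x : C) := (nonempty_isLimit_adjointWedge hP adj d hd hN x).some
  let e (x : C) : R.obj x ≅ end_ (homTensor k x) :=
    (h x).conePointUniqueUpToIso (limit.isLimit _)
  have he (x a : C) : (e x).hom ≫ end_.π (homTensor k x) a =
      copowerLift ((d (R.obj x)).transpose (adj.counit.app x) a) :=
    IsLimit.conePointUniqueUpToIso_hom_comp (h x) (limit.isLimit _) (.left a)
  have nat {x y : C} (f : x ⟶ y) :
      R.map f ≫ (e y).hom = (e x).hom ≫ end_.map (homTensorMap k f) := by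
    refine end_.hom_ext fun a => ?_
    rw [Category.assoc, Category.assoc, end_.map_π, he, ← Category.assoc (e x).hom, he]
    refine copower_hom_ext' fun η => ?_
    change (R.map f ≫ copowerLift (V := a ⟶ y) _) ≫ copowerEval (V := a ⟶ y) η =
      (copowerLift (V := a ⟶ x) _ ≫ copowerMap k (Linear.rightComp k a f) (𝟙 a)) ≫ copowerEval η
    rw [Category.assoc, Category.assoc, copowerMap_eval, Category.comp_id, copowerLift_eval,
      copowerLift_eval, comp_transpose d hN]
    refine eq_of_forall_dual (k := k) fun ξ => ?_
    refine ((d (R.obj x)).apply_transpose _ a η ξ).trans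
      (Eq.trans ?_ ((d (R.obj x)).apply_transpose _ a (η ∘ₗ Linear.rightComp k a f) ξ).symm)
    refine congrArg η (Eq.trans ?_ (Category.assoc _ _ _).symm)
    exact congrArg ((d (R.obj x)).ι a ξ ≫ ·) (adj.counit_naturality f)
  exact ⟨(NatIso.ofComponents e nat : R ≅ nakayamaL k C).symm⟩

end NakayamaL

/-! ### Duality and morphisms -/

section Mates

variable {A : Type u} [Category.{v} A] [MonoidalCategory A]

lemma tensorRightHomEquiv_comp_rightAdjointMate {a X Y Z : A} [HasRightDual X] [HasRightDual Y]
    (g : Y ⟶ X) (F : a ⊗ X ⟶ Z) :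
    tensorRightHomEquiv a X Xᘁ Z F ≫ Z ◁ gᘁ = tensorRightHomEquiv a Y Yᘁ Z (a ◁ g ≫ F) := by
  simp only [tensorRightHomEquiv, Equiv.coe_fn_mk, Category.assoc, comp_whiskerRight]
  rw [← whisker_exchange, ← associator_inv_naturality_right_assoc,
    ← associator_inv_naturality_middle_assoc, ← MonoidalCategory.whiskerLeft_comp_assoc,
    ← MonoidalCategory.whiskerLeft_comp_assoc, coevaluation_comp_rightAdjointMate]

lemma tensorRightHomEquiv_comp_whiskerLeft {a X Y Z : A} [HasLeftDual X] [HasLeftDual Y]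
    (f : X ⟶ Y) (F : a ⊗ (ᘁX : A) ⟶ Z) :
    tensorRightHomEquiv a (ᘁX) X Z F ≫ Z ◁ f =
      tensorRightHomEquiv a (ᘁY) Y Z (a ◁ leftAdjointMate f ≫ F) := by
  simp only [tensorRightHomEquiv, Equiv.coe_fn_mk, Category.assoc, comp_whiskerRight]
  rw [← whisker_exchange, ← associator_inv_naturality_right_assoc,
    ← associator_inv_naturality_middle_assoc, ← MonoidalCategory.whiskerLeft_comp_assoc,
    ← MonoidalCategory.whiskerLeft_comp_assoc, coevaluation_comp_leftAdjointMate]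

lemma tensorRightHomEquiv_symm_comp_rightAdjointMate {a b X Y : A} [HasRightDual X]
    [HasRightDual Y] (f : X ⟶ Y) (h : b ⟶ a ⊗ Yᘁ) :
    (tensorRightHomEquiv b X Xᘁ a).symm (h ≫ a ◁ fᘁ) =
      b ◁ f ≫ (tensorRightHomEquiv b Y Yᘁ a).symm h := by
  simp only [tensorRightHomEquiv, Equiv.coe_fn_symm_mk, Category.assoc, comp_whiskerRight]
  rw [whisker_exchange_assoc, associator_naturality_middle_assoc,
    associator_naturality_right_assoc, ← MonoidalCategory.whiskerLeft_comp_assoc,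
    ← MonoidalCategory.whiskerLeft_comp_assoc, rightAdjointMate_comp_evaluation]

lemma tensorLeftHomEquiv_comp_leftAdjointMate {a X Y Z : A} [HasLeftDual X] [HasLeftDual Y]
    (g : Y ⟶ X) (F : X ⊗ a ⟶ Z) :
    tensorLeftHomEquiv a (ᘁX) X Z F ≫ (ᘁg) ▷ Z = tensorLeftHomEquiv a (ᘁY) Y Z (g ▷ a ≫ F) := by
  simp only [tensorLeftHomEquiv, Equiv.coe_fn_mk, Category.assoc, MonoidalCategory.whiskerLeft_comp]
  rw [whisker_exchange, ← associator_naturality_left_assoc,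
    ← associator_naturality_middle_assoc, ← comp_whiskerRight_assoc,
    ← comp_whiskerRight_assoc, coevaluation_comp_leftAdjointMate]

lemma tensorLeftHomEquiv_symm_comp_leftAdjointMate {a b X Y : A} [HasLeftDual X]
    [HasLeftDual Y] (f : X ⟶ Y) (h : b ⟶ (ᘁY) ⊗ a) :
    (tensorLeftHomEquiv b (ᘁX) X a).symm (h ≫ (ᘁf) ▷ a) =
      f ▷ b ≫ (tensorLeftHomEquiv b (ᘁY) Y a).symm h := by
  simp only [tensorLeftHomEquiv, Equiv.coe_fn_symm_mk, Category.assoc,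
    MonoidalCategory.whiskerLeft_comp]
  rw [← whisker_exchange_assoc, associator_inv_naturality_middle_assoc,
    associator_inv_naturality_left_assoc, ← comp_whiskerRight_assoc,
    ← comp_whiskerRight_assoc, leftAdjointMate_comp_evaluation]

lemma tensorRightHomEquiv_comp_left {X X' Y Y' Z : A} [ExactPairing Y Y'] (f : X ⟶ X')
    (g : X' ⊗ Y ⟶ Z) :
    tensorRightHomEquiv X Y Y' Z (f ▷ Y ≫ g) = f ≫ tensorRightHomEquiv X' Y Y' Z g := by
  rw [← Equiv.eq_symm_apply, tensorRightHomEquiv_symm_naturality, Equiv.symm_apply_apply]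

lemma tensorLeftHomEquiv_comp_left {X X' Y Y' Z : A} [ExactPairing Y Y'] (f : X ⟶ X')
    (g : Y' ⊗ X' ⟶ Z) :
    tensorLeftHomEquiv X Y Y' Z (Y' ◁ f ≫ g) = f ≫ tensorLeftHomEquiv X' Y Y' Z g := by
  rw [← Equiv.eq_symm_apply, tensorLeftHomEquiv_symm_naturality, Equiv.symm_apply_apply]

lemma tensorRightHomEquiv_symm_comp {X Y Y' Z Z' : A} [ExactPairing Y Y'] (f : X ⟶ Z ⊗ Y')
    (g : Z ⟶ Z') : (tensorRightHomEquiv X Y Y' Z').symm (f ≫ g ▷ Y') =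
      (tensorRightHomEquiv X Y Y' Z).symm f ≫ g := by
  rw [Equiv.symm_apply_eq, tensorRightHomEquiv_naturality, Equiv.apply_symm_apply]

lemma tensorLeftHomEquiv_symm_comp {X Y Y' Z Z' : A} [ExactPairing Y Y'] (f : X ⟶ Y ⊗ Z)
    (g : Z ⟶ Z') : (tensorLeftHomEquiv X Y Y' Z').symm (f ≫ Y ◁ g) =
      (tensorLeftHomEquiv X Y Y' Z).symm f ≫ g := by
  rw [Equiv.symm_apply_eq, tensorLeftHomEquiv_naturality, Equiv.apply_symm_apply]

/-- Morphisms into the second object of an exact pairing are determined by their evaluation. -/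
lemma ExactPairing.hom_ext_right {X Y Z : A} [ExactPairing X Y] {f g : Z ⟶ Y}
    (h : f ▷ X ≫ ExactPairing.evaluation X Y = g ▷ X ≫ ExactPairing.evaluation X Y) : f = g := by
  have key (f : Z ⟶ Y) : tensorRightHomEquiv Z X Y (𝟙_ A)
      (f ▷ X ≫ ExactPairing.evaluation X Y) = f ≫ (λ_ Y).inv := by
    exact @tensorRightHomEquiv_whiskerRight_comp_evaluation A _ _ X Z ⟨Y⟩ f
  rw [← cancel_mono (λ_ Y).inv, ← key, ← key, h]

/-- Morphisms into the first object of an exact pairing are determined by their evaluation. -/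
lemma ExactPairing.hom_ext_left {X Y Z : A} [ExactPairing X Y] {f g : Z ⟶ X}
    (h : Y ◁ f ≫ ExactPairing.evaluation X Y = Y ◁ g ≫ ExactPairing.evaluation X Y) : f = g := by
  have key (f : Z ⟶ X) : tensorLeftHomEquiv Z X Y (𝟙_ A)
      (Y ◁ f ≫ ExactPairing.evaluation X Y) = f ≫ (ρ_ X).inv := by
    exact @tensorLeftHomEquiv_whiskerLeft_comp_evaluation A _ _ Z Y ⟨X⟩ f
  rw [← cancel_mono (ρ_ X).inv, ← key, ← key, h]

section Linear

variable (k : Type w) [Field k] [Preadditive A] [Linear k A] [MonoidalPreadditive A]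
  [MonoidalLinear k A]

/-- `tensorRightHomEquiv` as a linear isomorphism. -/
def tensorRightHomₗ (X Y Y' Z : A) [ExactPairing Y Y'] : (X ⊗ Y ⟶ Z) ≃ₗ[k] (X ⟶ Z ⊗ Y') :=
  { tensorRightHomEquiv X Y Y' Z with
    map_add' := fun f g => by simp [tensorRightHomEquiv]
    map_smul' := fun c f => by simp [tensorRightHomEquiv] }

/-- `tensorLeftHomEquiv` as a linear isomorphism. -/
def tensorLeftHomₗ (X Y Y' Z : A) [ExactPairing Y Y'] : (Y' ⊗ X ⟶ Z) ≃ₗ[k] (X ⟶ Y ⊗ Z) :=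
  { tensorLeftHomEquiv X Y Y' Z with
    map_add' := fun f g => by simp [tensorLeftHomEquiv]
    map_smul' := fun c f => by simp [tensorLeftHomEquiv] }

/-- Precomposition with an isomorphism as a linear isomorphism. -/
def precompₗ {X Y : A} (i : X ≅ Y) (Z : A) : (Y ⟶ Z) ≃ₗ[k] (X ⟶ Z) :=
  LinearEquiv.ofLinearMap (Linear.leftComp k Z i.hom) (Linear.leftComp k Z i.inv)
    (by ext; simp) (by ext; simp)

/-- Postcomposition with an isomorphism as a linear isomorphism. -/
def postcompₗ {X Y : A} (Z : A) (i : X ≅ Y) : (Z ⟶ X) ≃ₗ[k] (Z ⟶ Y) :=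
  LinearEquiv.ofLinearMap (Linear.rightComp k Z i.hom) (Linear.rightComp k Z i.inv)
    (by ext; simp) (by ext; simp)

end Linear

end Mates

/-! ### Projective objects in rigid categories -/

section Projective

variable {A : Type u} [Category.{v} A] [MonoidalCategory A] [RigidCategory A]

lemma epi_whiskerLeft (x : A) {y z : A} (f : y ⟶ z) [Epi f] : Epi (x ◁ f) := by
  have := Functor.preservesEpimorphisms_of_adjunction (tensorLeftAdjunction (ᘁx) x)
  exact inferInstanceAs (Epi ((tensorLeft x).map f))

lemma epi_whiskerRight (x : A) {y z : A} (f : y ⟶ z) [Epi f] : Epi (f ▷ x) := by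
  have := Functor.preservesEpimorphisms_of_adjunction (tensorRightAdjunction x (xᘁ))
  exact inferInstanceAs (Epi ((tensorRight x).map f))

lemma projective_tensor_left (P x : A) [hP : Projective P] : Projective (P ⊗ x) :=
  have : (tensorRight (xᘁ)).PreservesEpimorphisms := ⟨fun f _ => epi_whiskerRight (xᘁ) f⟩
  (tensorRightAdjunction x (xᘁ)).map_projective P hP

lemma projective_tensor_right (x P : A) [hP : Projective P] : Projective (x ⊗ P) :=
  have : (tensorLeft (ᘁx)).PreservesEpimorphisms := ⟨fun f _ => epi_whiskerLeft (ᘁx) f⟩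
  (tensorLeftAdjunction (ᘁx) x).map_projective P hP

/-- Left duals of projective objects are projective: `- ⊗ P` turns epimorphisms into split ones,
and `Hom (^∨P, -) ≅ Hom (𝟙, - ⊗ P)`. -/
lemma projective_of_exactPairing_left (P' P : A) [ExactPairing P' P] [Projective P] :
    Projective P' := by
  refine ⟨fun {y z} q e _ => ?_⟩
  have := epi_whiskerRight P e
  have := projective_tensor_right z P
  let q' := tensorRightHomEquiv (𝟙_ A) P' P z ((λ_ P').hom ≫ q)
  let f := (tensorRightHomEquiv (𝟙_ A) P' P y).symm (q' ≫ Projective.factorThru (𝟙 _) (e ▷ P))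
  have hf : f ≫ e = (λ_ P').hom ≫ q := by
    rw [← tensorRightHomEquiv_symm_comp, Category.assoc, Projective.factorThru_comp,
      Category.comp_id, Equiv.symm_apply_apply]
  exact ⟨(λ_ P').inv ≫ f, by rw [Category.assoc, hf, Iso.inv_hom_id_assoc]⟩

end Projective

/-! ### The right exact Nakayama functor in terms of its value at the unit -/

section Rigid

variable {k : Type w} [Field k] {A : Type u} [Category.{v} A] [Preadditive A] [Linear k A]
  [MonoidalCategory A] [MonoidalPreadditive A] [MonoidalLinear k A] [RigidCategory A]

variable (k) in
/-- The isomorphism `Hom (𝟙, a ⊗ x^∨) ≅ Hom (x, a)`. -/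
def homUnitTensorRightDual (x a : A) : (𝟙_ A ⟶ a ⊗ xᘁ) ≃ₗ[k] (x ⟶ a) :=
  (tensorRightHomₗ k (𝟙_ A) x (xᘁ) a).symm.trans (precompₗ k (λ_ x).symm a)

lemma homUnitTensorRightDual_apply (x a : A) (h : 𝟙_ A ⟶ a ⊗ xᘁ) :
    homUnitTensorRightDual k x a h = (λ_ x).inv ≫ (tensorRightHomEquiv (𝟙_ A) x (xᘁ) a).symm h :=
  rfl

variable (k) in
/-- The isomorphism `Hom (𝟙, ^∨x ⊗ a) ≅ Hom (x, a)`. -/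
def homUnitTensorLeftDual (x a : A) : (𝟙_ A ⟶ (ᘁx : A) ⊗ a) ≃ₗ[k] (x ⟶ a) :=
  (tensorLeftHomₗ k (𝟙_ A) (ᘁx) x a).symm.trans (precompₗ k (ρ_ x).symm a)

lemma homUnitTensorLeftDual_apply (x a : A) (h : 𝟙_ A ⟶ (ᘁx : A) ⊗ a) :
    homUnitTensorLeftDual k x a h = (ρ_ x).inv ≫ (tensorLeftHomEquiv (𝟙_ A) (ᘁx) x a).symm h :=
  rfl

namespace DualFamily

variable {D : A} (d : DualFamily k (𝟙_ A) D)

/-- The family `Hom (x, a)^* ≅ Hom (𝟙, a ⊗ x^∨)^* → Hom (a ⊗ x^∨, D) ≅ Hom (a, D ⊗ x^∨∨)`. -/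
def tensorDoubleDual (x : A) : DualFamily k x (D ⊗ (xᘁ)ᘁ) where
  ι a := (tensorRightHomₗ k a (xᘁ) ((xᘁ)ᘁ) D).toLinearMap ∘ₗ d.ι (a ⊗ xᘁ) ∘ₗ
    (homUnitTensorRightDual k x a).toLinearMap.dualMap
  comp_ι {a b} g ξ := by
    refine (tensorRightHomEquiv_comp_left g _).symm.trans ?_
    refine congrArg (tensorRightHomEquiv a (xᘁ) ((xᘁ)ᘁ) D) ((d.comp_ι _ _).trans ?_)
    refine congrArg (d.ι (a ⊗ xᘁ)) (LinearMap.ext fun h => congrArg ξ ?_)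
    change homUnitTensorRightDual k x b (h ≫ g ▷ xᘁ) = homUnitTensorRightDual k x a h ≫ g
    rw [homUnitTensorRightDual_apply, homUnitTensorRightDual_apply, tensorRightHomEquiv_symm_comp,
      Category.assoc]

lemma tensorDoubleDual_map {x y : A} (f : x ⟶ y) (a : A) (ξ : Module.Dual k (x ⟶ a)) :
    (d.tensorDoubleDual x).ι a ξ ≫ D ◁ (fᘁ)ᘁ =
      (d.tensorDoubleDual y).ι a (ξ ∘ₗ Linear.leftComp k a f) := by
  refine (tensorRightHomEquiv_comp_rightAdjointMate (fᘁ) _).trans ?_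
  refine congrArg (tensorRightHomEquiv a (yᘁ) ((yᘁ)ᘁ) D) ((d.comp_ι _ _).trans ?_)
  refine congrArg (d.ι (a ⊗ yᘁ)) (LinearMap.ext fun h => congrArg ξ ?_)
  change homUnitTensorRightDual k x a (h ≫ a ◁ fᘁ) = f ≫ homUnitTensorRightDual k y a h
  rw [homUnitTensorRightDual_apply, homUnitTensorRightDual_apply,
    tensorRightHomEquiv_symm_comp_rightAdjointMate, ← leftUnitor_inv_naturality_assoc]

/-- The family `Hom (x, a)^* ≅ Hom (𝟙, ^∨x ⊗ a)^* → Hom (^∨x ⊗ a, D) ≅ Hom (a, ^∨∨x ⊗ D)`. -/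
def doubleDualTensor (x : A) : DualFamily k x ((ᘁ(ᘁx) : A) ⊗ D) where
  ι a := (tensorLeftHomₗ k a (ᘁ(ᘁx)) (ᘁx) D).toLinearMap ∘ₗ d.ι ((ᘁx) ⊗ a) ∘ₗ
    (homUnitTensorLeftDual k x a).toLinearMap.dualMap
  comp_ι {a b} g ξ := by
    refine (tensorLeftHomEquiv_comp_left g _).symm.trans ?_
    refine congrArg (tensorLeftHomEquiv a (ᘁ(ᘁx)) (ᘁx) D) ((d.comp_ι _ _).trans ?_)
    refine congrArg (d.ι ((ᘁx) ⊗ a)) (LinearMap.ext fun h => congrArg ξ ?_)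
    change homUnitTensorLeftDual k x b (h ≫ (ᘁx) ◁ g) = homUnitTensorLeftDual k x a h ≫ g
    rw [homUnitTensorLeftDual_apply, homUnitTensorLeftDual_apply, tensorLeftHomEquiv_symm_comp,
      Category.assoc]

lemma doubleDualTensor_map {x y : A} (f : x ⟶ y) (a : A) (ξ : Module.Dual k (x ⟶ a)) :
    (d.doubleDualTensor x).ι a ξ ≫ (leftAdjointMate (leftAdjointMate f)) ▷ D =
      (d.doubleDualTensor y).ι a (ξ ∘ₗ Linear.leftComp k a f) := by
  refine (tensorLeftHomEquiv_comp_leftAdjointMate (leftAdjointMate f) _).trans ?_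
  refine congrArg (tensorLeftHomEquiv a (ᘁ(ᘁy)) (ᘁy) D) ((d.comp_ι _ _).trans ?_)
  refine congrArg (d.ι ((ᘁy) ⊗ a)) (LinearMap.ext fun h => congrArg ξ ?_)
  change homUnitTensorLeftDual k x a (h ≫ (leftAdjointMate f) ▷ a) =
    f ≫ homUnitTensorLeftDual k y a h
  rw [homUnitTensorLeftDual_apply, homUnitTensorLeftDual_apply,
    tensorLeftHomEquiv_symm_comp_leftAdjointMate, ← rightUnitor_inv_naturality_assoc]

variable [IsFiniteLinear k A] {P : A} (hP : IsRegularGenerator k P)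
  (hd : Function.Bijective (d.ι P))

include hP hd in
lemma tensorDoubleDual_bijective (x : A) : Function.Bijective ((d.tensorDoubleDual x).ι P) := by
  have := hP.projective
  have := projective_tensor_left P (xᘁ)
  exact (tensorRightHomₗ k P (xᘁ) ((xᘁ)ᘁ) D).bijective.comp
    ((d.bijective_of_projective hP hd (P ⊗ xᘁ)).comp
      (homUnitTensorRightDual k x P).dualMap.bijective)

include hP hd in
lemma doubleDualTensor_bijective (x : A) : Function.Bijective ((d.doubleDualTensor x).ι P) := by
  have := hP.projective
  have := projective_tensor_right (ᘁx) P
  exact (tensorLeftHomₗ k P (ᘁ(ᘁx)) (ᘁx) D).bijective.comp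
    ((d.bijective_of_projective hP hd ((ᘁx) ⊗ P)).comp
      (homUnitTensorLeftDual k x P).dualMap.bijective)

/-! ### Invertibility of the value at the unit -/

include hP hd in
/-- Tensoring with `D` is faithful, because `Hom (^∨P, D ⊗ y) ≅ Hom (^∨P ⊗ ^∨y, D)` is dual to
`Hom (𝟙, ^∨P ⊗ ^∨y) ≅ Hom (P, ^∨y)`. -/
lemma eq_zero_of_whiskerLeft_eq_zero {x y : A} (f : y ⟶ x) (hf : D ◁ f = 0) : f = 0 := by
  have := hP.projective
  let Q : A := ᘁP
  have := projective_of_exactPairing_left Q P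
  have := projective_tensor_left Q (ᘁx)
  suffices h : leftAdjointMate f = 0 by
    have h' := leftAdjointMate_comp_evaluation f
    rw [h, MonoidalPreadditive.whiskerLeft_zero, zero_comp] at h'
    exact ExactPairing.hom_ext_right (X := (ᘁx : A)) (by
      rw [← h', MonoidalPreadditive.zero_whiskerRight, zero_comp])
  refine hP.hom_ext fun p => ?_
  rw [comp_zero]
  let p' : 𝟙_ A ⟶ Q ⊗ (ᘁx) := (homUnitTensorLeftDual k P (ᘁx)).symm p
  have hp : p' ≫ Q ◁ leftAdjointMate f = 0 := by
    refine eq_of_forall_dual (k := k) fun ξ => ?_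
    have h0 : Q ◁ leftAdjointMate f ≫ d.ι (Q ⊗ (ᘁy)) ξ = 0 := by
      refine (tensorRightHomₗ k Q (ᘁx) x D).injective ?_
      refine (tensorRightHomEquiv_comp_whiskerLeft f (d.ι (Q ⊗ (ᘁy)) ξ)).symm.trans ?_
      rw [hf, comp_zero, map_zero]
    rw [d.comp_ι] at h0
    have h1 := (d.bijective_of_projective hP hd (Q ⊗ (ᘁx))).1 (h0.trans (map_zero _).symm)
    exact (LinearMap.congr_fun h1 p').trans (map_zero ξ).symm
  have hp' : homUnitTensorLeftDual k P (ᘁy) (p' ≫ Q ◁ leftAdjointMate f) =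
      p ≫ leftAdjointMate f := by
    rw [homUnitTensorLeftDual_apply, tensorLeftHomEquiv_symm_comp, ← Category.assoc,
      ← homUnitTensorLeftDual_apply (k := k)]
    exact congrArg (· ≫ _) ((homUnitTensorLeftDual k P (ᘁx)).apply_symm_apply p)
  rw [← hp', hp, map_zero]

include hP hd in
/-- Morphisms `D ⊗ z ⟶ D` out of `D ⊗ z`, for `z` projective, come from morphisms `z ⟶ 𝟙`: both
spaces have the same dimension. -/
lemma bijective_whiskerLeft (z : A) [Projective z] :
    Function.Bijective fun f : z ⟶ 𝟙_ A => D ◁ f ≫ (ρ_ D).hom := by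
  let Φ : (z ⟶ 𝟙_ A) →ₗ[k] (D ⊗ z ⟶ D) :=
    { toFun := fun f => D ◁ f ≫ (ρ_ D).hom
      map_add' := fun f g => by simp
      map_smul' := fun c f => by simp }
  have inj : Function.Injective Φ := (injective_iff_map_eq_zero Φ).2 fun f hf =>
    d.eq_zero_of_whiskerLeft_eq_zero hP hd f ((cancel_mono (ρ_ D).hom).1 (hf.trans zero_comp.symm))
  have := projective_tensor_right D z
  have := projective_of_exactPairing_left (ᘁz) z
  -- `dim Hom (D ⊗ z, D) = dim Hom (𝟙, D ⊗ z) = dim Hom (^∨z, D) = dim Hom (𝟙, ^∨z)`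
  have dim : Module.finrank k (z ⟶ 𝟙_ A) = Module.finrank k (D ⊗ z ⟶ D) := by
    rw [d.finrank_hom_eq hP hd (D ⊗ z),
      (tensorRightHomₗ k (𝟙_ A) (ᘁz) z D).finrank_eq.symm,
      (precompₗ k (λ_ (ᘁz : A)) D).finrank_eq.symm, d.finrank_hom_eq hP hd (ᘁz),
      ← (homUnitTensorLeftDual k z (𝟙_ A)).finrank_eq,
      (postcompₗ k (𝟙_ A) (ρ_ (ᘁz : A))).finrank_eq]
  exact ⟨inj, (LinearMap.injective_iff_surjective_of_finrank_eq_finrank dim).1 inj⟩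

end DualFamily

/-- The coevaluation `𝟙 ⟶ ^∨D ⊗ D` is an isomorphism. -/
lemma DualFamily.nonempty_leftDual_tensor_iso [IsFiniteLinear k A] {P D : A}
    (hP : IsRegularGenerator k P) (d : DualFamily k (𝟙_ A) D) (hd : Function.Bijective (d.ι P)) :
    Nonempty ((ᘁD : A) ⊗ D ≅ 𝟙_ A) := by
  have := hP.projective
  let u : 𝟙_ A ⟶ (ᘁD : A) ⊗ D := tensorLeftHomEquiv (𝟙_ A) (ᘁD) D D (ρ_ D).hom
  have hu : IsIso u := by
    refine hP.isIso_of_bijective u ?_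
    convert (tensorLeftHomEquiv P (ᘁD) D D).bijective.comp (d.bijective_whiskerLeft hP hd P)
      using 2 with p
    exact (tensorLeftHomEquiv_comp_left p _).symm
  exact ⟨(asIso u).symm⟩

end Rigid

/-! ### The double dual functors -/

section DoubleDual

variable {A : Type u} [Category.{v} A] [MonoidalCategory A]

section Uniqueness

variable {X X' Y Y' : A}

/-- The comparison isomorphism between two right duals of the same object. -/
lemma exists_rightDual_iso (p : ExactPairing X Y) (q : ExactPairing X Y') :
    ∃ e : Y ≅ Y', e.hom ▷ X ≫ q.evaluation' = p.evaluation' := by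
  refine ⟨rightDualIso p q, ?_⟩
  have h := @rightAdjointMate_comp_evaluation A _ _ X X ⟨Y'⟩ ⟨Y⟩ (𝟙 X)
  rw [MonoidalCategory.whiskerLeft_id, Category.id_comp] at h
  exact h

/-- The comparison isomorphism between two left duals of the same object. -/
lemma exists_leftDual_iso (p : ExactPairing X Y) (q : ExactPairing X' Y) :
    ∃ e : X ≅ X', Y ◁ e.hom ≫ q.evaluation' = p.evaluation' := by
  refine ⟨leftDualIso p q, ?_⟩
  have h := @leftAdjointMate_comp_evaluation A _ _ Y Y ⟨X'⟩ ⟨X⟩ (𝟙 Y)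
  rw [id_whiskerRight, Category.id_comp] at h
  exact h

end Uniqueness

variable (A) in
/-- The right dual as a contravariant functor. -/
def rightDualFunctor [RightRigidCategory A] : Aᵒᵖ ⥤ A where
  obj X := X.unopᘁ
  map f := f.unopᘁ
  map_id X := by simp
  map_comp f g := by simp [comp_rightAdjointMate]

variable (A) in
/-- The left dual as a contravariant functor. -/
def leftDualFunctor [LeftRigidCategory A] : Aᵒᵖ ⥤ A where
  obj X := (ᘁX.unop : A)
  map f := leftAdjointMate f.unop
  map_id X := by simp
  map_comp f g := by simp [comp_leftAdjointMate]

variable [RigidCategory A]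

instance pairingRight (X : A) : ExactPairing X ((rightDualFunctor A).obj (op X)) :=
  inferInstanceAs (ExactPairing X (Xᘁ))

instance pairingLeft (X : A) : ExactPairing ((leftDualFunctor A).obj (op X)) X :=
  inferInstanceAs (ExactPairing (ᘁX : A) X)

lemma rightDualFunctor_evaluation {X Y : A} (f : X ⟶ Y) :
    (rightDualFunctor A).map f.op ▷ X ≫ ExactPairing.evaluation X _ =
      (rightDualFunctor A).obj (op Y) ◁ f ≫ ExactPairing.evaluation Y _ :=
  rightAdjointMate_comp_evaluation f

lemma leftDualFunctor_evaluation {X Y : A} (f : X ⟶ Y) :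
    X ◁ (leftDualFunctor A).map f.op ≫ ExactPairing.evaluation _ X =
      f ▷ (leftDualFunctor A).obj (op Y) ≫ ExactPairing.evaluation _ Y :=
  leftAdjointMate_comp_evaluation f

variable (A) in
/-- The left dual is inverse to the right dual. -/
lemma nonempty_rightDual_leftDual_iso :
    Nonempty ((rightDualFunctor A).rightOp ⋙ leftDualFunctor A ≅ 𝟭 A) := by
  let R := rightDualFunctor A
  let L := leftDualFunctor A
  choose e he using fun X : A =>
    exists_leftDual_iso (pairingLeft (R.obj (op X))) (pairingRight X)
  have he' (X : A) : R.obj (op X) ◁ (e X).hom ≫ ExactPairing.evaluation X (R.obj (op X)) =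
      ExactPairing.evaluation (L.obj (op (R.obj (op X)))) (R.obj (op X)) := he X
  have nat {X Y : A} (f : X ⟶ Y) :
      L.map (R.map f.op).op ≫ (e Y).hom = (e X).hom ≫ f := by
    refine ExactPairing.hom_ext_left (Y := R.obj (op Y)) ?_
    rw [MonoidalCategory.whiskerLeft_comp, MonoidalCategory.whiskerLeft_comp, Category.assoc,
      Category.assoc, he', leftDualFunctor_evaluation, ← rightDualFunctor_evaluation,
      whisker_exchange_assoc, he']
  exact ⟨NatIso.ofComponents e nat⟩

variable (A) in
/-- The right dual is inverse to the left dual. -/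
lemma nonempty_leftDual_rightDual_iso :
    Nonempty ((leftDualFunctor A).rightOp ⋙ rightDualFunctor A ≅ 𝟭 A) := by
  let R := rightDualFunctor A
  let L := leftDualFunctor A
  choose e he using fun X : A =>
    exists_rightDual_iso (pairingRight (L.obj (op X))) (pairingLeft X)
  have he' (X : A) : (e X).hom ▷ L.obj (op X) ≫ ExactPairing.evaluation (L.obj (op X)) X =
      ExactPairing.evaluation (L.obj (op X)) (R.obj (op (L.obj (op X)))) := he X
  have nat {X Y : A} (f : X ⟶ Y) :
      R.map (L.map f.op).op ≫ (e Y).hom = (e X).hom ≫ f := by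
    refine ExactPairing.hom_ext_right (X := L.obj (op Y)) ?_
    rw [comp_whiskerRight, comp_whiskerRight, Category.assoc,
      Category.assoc, he', rightDualFunctor_evaluation, ← leftDualFunctor_evaluation,
      ← whisker_exchange_assoc, he']
  exact ⟨NatIso.ofComponents e nat⟩

variable (A) in
lemma nonempty_rightDoubleDual_leftDoubleDual_iso :
    Nonempty (rightDoubleDual A ⋙ leftDoubleDual A ≅ 𝟭 A) := by
  obtain ⟨c⟩ := nonempty_rightDual_leftDual_iso A
  let j : 𝟭 Aᵒᵖ ≅ rightDualFunctor A ⋙ (leftDualFunctor A).rightOp :=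
    NatIso.ofComponents (fun X => (c.app X.unop).op) fun f =>
      Quiver.Hom.unop_inj (c.hom.naturality f.unop).symm
  exact ⟨(Functor.isoWhiskerLeft (rightDualFunctor A).rightOp
    (Functor.isoWhiskerRight j.symm (leftDualFunctor A)) :
      rightDoubleDual A ⋙ leftDoubleDual A ≅ (rightDualFunctor A).rightOp ⋙ leftDualFunctor A) ≪≫ c⟩

variable (A) in
lemma nonempty_leftDoubleDual_rightDoubleDual_iso :
    Nonempty (leftDoubleDual A ⋙ rightDoubleDual A ≅ 𝟭 A) := by
  obtain ⟨c⟩ := nonempty_leftDual_rightDual_iso A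
  let j : 𝟭 Aᵒᵖ ≅ leftDualFunctor A ⋙ (rightDualFunctor A).rightOp :=
    NatIso.ofComponents (fun X => (c.app X.unop).op) fun f =>
      Quiver.Hom.unop_inj (c.hom.naturality f.unop).symm
  exact ⟨(Functor.isoWhiskerLeft (leftDualFunctor A).rightOp
    (Functor.isoWhiskerRight j.symm (rightDualFunctor A)) :
      leftDoubleDual A ⋙ rightDoubleDual A ≅ (leftDualFunctor A).rightOp ⋙ rightDualFunctor A) ≪≫ c⟩

/-- The comparison `(x ⊗ y)^∨ ≅ y^∨ ⊗ x^∨` is natural. -/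
lemma exists_rightDual_tensor_iso : ∃ t : ∀ x y : A, (x ⊗ y)ᘁ ≅ yᘁ ⊗ xᘁ,
    ∀ {x x' y y' : A} (f : x ⟶ x') (g : y ⟶ y'),
      (f ⊗ₘ g)ᘁ ≫ (t x y).hom = (t x' y').hom ≫ (gᘁ ⊗ₘ fᘁ) := by
  choose t ht using fun x y : A =>
    exists_rightDual_iso (HasRightDual.exact : ExactPairing (x ⊗ y) ((x ⊗ y)ᘁ))
      (ExactPairing.tensor (X₁ := x) (X₂ := y) (Y₁ := xᘁ) (Y₂ := yᘁ))
  have ht' (x y : A) : (t x y).hom ▷ (x ⊗ y) ≫ ExactPairing.evaluation (x ⊗ y) (yᘁ ⊗ xᘁ) =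
      ExactPairing.evaluation (x ⊗ y) ((x ⊗ y)ᘁ) := ht x y
  have mate {x x' y y' : A} (f : x ⟶ x') (g : y ⟶ y') :
      (gᘁ ⊗ₘ fᘁ) ▷ (x ⊗ y) ≫ ExactPairing.evaluation (x ⊗ y) (yᘁ ⊗ xᘁ) =
        (y'ᘁ ⊗ x'ᘁ) ◁ (f ⊗ₘ g) ≫ ExactPairing.evaluation (x' ⊗ y') (y'ᘁ ⊗ x'ᘁ) := by
    rw [ExactPairing.tensor_evaluation, ExactPairing.tensor_evaluation]
    calc _ = 𝟙 _ ⊗≫ (gᘁ ▷ (x'ᘁ ⊗ x) ≫ (yᘁ : A) ◁ (fᘁ ▷ x ≫ ExactPairing.evaluation x (xᘁ))) ▷ y ⊗≫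
          ExactPairing.evaluation y (yᘁ) := by
            rw [MonoidalCategory.tensorHom_def]; monoidal
      _ = 𝟙 _ ⊗≫ (gᘁ ▷ (x'ᘁ ⊗ x) ≫
            (yᘁ : A) ◁ ((x'ᘁ : A) ◁ f ≫ ExactPairing.evaluation x' (x'ᘁ))) ▷ y ⊗≫
          ExactPairing.evaluation y (yᘁ) := by
            rw [rightAdjointMate_comp_evaluation]
      _ = 𝟙 _ ⊗≫ ((y'ᘁ : A) ◁ ((x'ᘁ : A) ◁ f ≫ ExactPairing.evaluation x' (x'ᘁ))) ▷ y ⊗≫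
          (gᘁ ▷ y ≫ ExactPairing.evaluation y (yᘁ)) := by
            rw [← whisker_exchange]; monoidal
      _ = 𝟙 _ ⊗≫ (y'ᘁ : A) ◁ ((x'ᘁ : A) ◁ f ≫ ExactPairing.evaluation x' (x'ᘁ)) ▷ y ⊗≫
          ((y'ᘁ : A) ◁ g ≫ ExactPairing.evaluation y' (y'ᘁ)) := by
            rw [rightAdjointMate_comp_evaluation]; monoidal
      _ = 𝟙 _ ⊗≫ ((y'ᘁ : A) ◁ (x'ᘁ : A) ◁ f) ▷ y ⊗≫
          (y'ᘁ : A) ◁ (ExactPairing.evaluation x' (x'ᘁ) ▷ y ≫ 𝟙_ A ◁ g) ⊗≫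
          ExactPairing.evaluation y' (y'ᘁ) := by monoidal
      _ = _ := by
            rw [← whisker_exchange, MonoidalCategory.tensorHom_def]; monoidal
  refine ⟨t, fun {x x' y y'} f g => ExactPairing.hom_ext_right (X := x ⊗ y) ?_⟩
  rw [comp_whiskerRight, comp_whiskerRight, Category.assoc, Category.assoc, ht',
    rightAdjointMate_comp_evaluation, mate, ← whisker_exchange_assoc, ht']

variable (A) in
/-- The double right dual functor preserves tensor products. -/
lemma exists_rightDoubleDual_tensor_iso : ∃ t : ∀ x y : A,
    (rightDoubleDual A).obj (x ⊗ y) ≅ (rightDoubleDual A).obj x ⊗ (rightDoubleDual A).obj y,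
    ∀ {x x' y y' : A} (f : x ⟶ x') (g : y ⟶ y'),
      (rightDoubleDual A).map (f ⊗ₘ g) ≫ (t x' y').hom =
        (t x y).hom ≫ ((rightDoubleDual A).map f ⊗ₘ (rightDoubleDual A).map g) := by
  obtain ⟨t, ht⟩ := exists_rightDual_tensor_iso (A := A)
  have ht' {x x' y y' : A} (f : x ⟶ x') (g : y ⟶ y') :
      (t x' y').inv ≫ (f ⊗ₘ g)ᘁ = (gᘁ ⊗ₘ fᘁ) ≫ (t x y).inv := by
    rw [Iso.inv_comp_eq, ← Category.assoc, ← ht, Category.assoc, Iso.hom_inv_id, Category.comp_id]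
  refine ⟨fun x y => (rightDualFunctor A).mapIso (t x y).symm.op ≪≫ t (yᘁ) (xᘁ),
    fun {x x' y y'} f g => ?_⟩
  change ((f ⊗ₘ g)ᘁ)ᘁ ≫ ((t x' y').inv)ᘁ ≫ (t (y'ᘁ) (x'ᘁ)).hom =
    (((t x y).inv)ᘁ ≫ (t (yᘁ) (xᘁ)).hom) ≫ ((fᘁ)ᘁ ⊗ₘ (gᘁ)ᘁ)
  rw [Category.assoc, ← ht, ← comp_rightAdjointMate_assoc, ← comp_rightAdjointMate_assoc, ht']

lemma nonempty_tensorLeft_rightDoubleDual_iso (c : A) :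
    Nonempty (tensorLeft c ⋙ rightDoubleDual A ≅
      rightDoubleDual A ⋙ tensorLeft ((rightDoubleDual A).obj c)) := by
  obtain ⟨t, ht⟩ := exists_rightDoubleDual_tensor_iso A
  exact ⟨NatIso.ofComponents (fun x => t c x) fun {x y} f => by
    have h := ht (𝟙 c) f
    rwa [id_tensorHom, CategoryTheory.Functor.map_id, id_tensorHom] at h⟩

lemma nonempty_tensorRight_rightDoubleDual_iso (c : A) :
    Nonempty (tensorRight c ⋙ rightDoubleDual A ≅
      rightDoubleDual A ⋙ tensorRight ((rightDoubleDual A).obj c)) := by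
  obtain ⟨t, ht⟩ := exists_rightDoubleDual_tensor_iso A
  exact ⟨NatIso.ofComponents (fun x => t x c) fun {x y} f => by
    have h := ht f (𝟙 c)
    rwa [tensorHom_id, CategoryTheory.Functor.map_id, tensorHom_id] at h⟩

variable (A) in
lemma nonempty_rightDoubleDual_adj : Nonempty (rightDoubleDual A ⊣ leftDoubleDual A) := by
  obtain ⟨η⟩ := nonempty_rightDoubleDual_leftDoubleDual_iso A
  obtain ⟨ε⟩ := nonempty_leftDoubleDual_rightDoubleDual_iso A
  exact ⟨(CategoryTheory.Equivalence.mk _ _ η.symm ε).toAdjunction⟩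

variable (A) in
lemma nonempty_leftDoubleDual_adj : Nonempty (leftDoubleDual A ⊣ rightDoubleDual A) := by
  obtain ⟨η⟩ := nonempty_rightDoubleDual_leftDoubleDual_iso A
  obtain ⟨ε⟩ := nonempty_leftDoubleDual_rightDoubleDual_iso A
  exact ⟨(CategoryTheory.Equivalence.mk _ _ ε.symm η).toAdjunction⟩

end DoubleDual

/-! ### Invertible objects -/

section Invertible

variable {A : Type u} [Category.{v} A] [MonoidalCategory A] {D E : A}

/-- Isomorphic objects give isomorphic functors of tensoring on the left. -/
def tensorLeftIso {x y : A} (i : x ≅ y) : tensorLeft x ≅ tensorLeft y :=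
  NatIso.ofComponents (fun z => whiskerRightIso i z) fun f => whisker_exchange i.hom f

/-- Isomorphic objects give isomorphic functors of tensoring on the right. -/
def tensorRightIso {x y : A} (i : x ≅ y) : tensorRight x ≅ tensorRight y :=
  NatIso.ofComponents (fun z => whiskerLeftIso z i) fun f => (whisker_exchange f i.hom).symm

lemma IsTensorInverse.symm (h : IsTensorInverse D E) : IsTensorInverse E D := ⟨h.2, h.1⟩

/-- A left inverse and a right inverse of an object agree. -/
lemma isTensorInverse_of_iso {X : A} (i : E ⊗ D ≅ 𝟙_ A) (j : D ⊗ X ≅ 𝟙_ A) :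
    IsTensorInverse D E := by
  let e : E ≅ X := (ρ_ E).symm ≪≫ whiskerLeftIso E j.symm ≪≫ (α_ E D X).symm ≪≫
    whiskerRightIso i X ≪≫ λ_ X
  exact ⟨⟨whiskerLeftIso D e ≪≫ j⟩, ⟨i⟩⟩

lemma IsTensorInverse.congr {D' E' : A} (h : IsTensorInverse D E) (i : D ≅ D') (j : E ≅ E') :
    IsTensorInverse D' E' := by
  obtain ⟨⟨a⟩, ⟨b⟩⟩ := h
  exact ⟨⟨(i ⊗ᵢ j).symm ≪≫ a⟩, ⟨(j ⊗ᵢ i).symm ≪≫ b⟩⟩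

lemma IsTensorInverse.nonempty_tensorRight_comp (h : IsTensorInverse D E) :
    Nonempty (tensorRight D ⋙ tensorRight E ≅ 𝟭 A) := by
  obtain ⟨⟨a⟩, _⟩ := h
  exact ⟨(tensorRightTensor D E).symm ≪≫ tensorRightIso a ≪≫ rightUnitorNatIso A⟩

lemma IsTensorInverse.nonempty_tensorLeft_comp (h : IsTensorInverse D E) :
    Nonempty (tensorLeft E ⋙ tensorLeft D ≅ 𝟭 A) := by
  obtain ⟨⟨a⟩, _⟩ := h
  exact ⟨(tensorLeftTensor D E).symm ≪≫ tensorLeftIso a ≪≫ leftUnitorNatIso A⟩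

lemma IsTensorInverse.nonempty_tensorRight_adj (h : IsTensorInverse D E) :
    Nonempty (tensorRight D ⊣ tensorRight E) := by
  obtain ⟨η⟩ := h.nonempty_tensorRight_comp
  obtain ⟨ε⟩ := h.symm.nonempty_tensorRight_comp
  exact ⟨(CategoryTheory.Equivalence.mk _ _ η.symm ε).toAdjunction⟩

lemma IsTensorInverse.nonempty_tensorLeft_adj (h : IsTensorInverse D E) :
    Nonempty (tensorLeft D ⊣ tensorLeft E) := by
  obtain ⟨ε⟩ := h.nonempty_tensorLeft_comp
  obtain ⟨η⟩ := h.symm.nonempty_tensorLeft_comp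
  exact ⟨(CategoryTheory.Equivalence.mk _ _ η.symm ε).toAdjunction⟩

variable [RigidCategory A]

/-- The dual of an invertible object is its inverse. -/
lemma IsTensorInverse.nonempty_rightDual_iso (h : IsTensorInverse D E) : Nonempty (Dᘁ ≅ E) := by
  obtain ⟨adj⟩ := h.nonempty_tensorRight_adj
  exact ⟨(λ_ _).symm ≪≫
    ((tensorRightAdjunction D (Dᘁ)).rightAdjointUniq adj).app (𝟙_ A) ≪≫ λ_ _⟩

/-- Invertible objects are isomorphic to their double duals. -/
lemma IsTensorInverse.nonempty_rightDoubleDual_iso (h : IsTensorInverse D E) :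
    Nonempty ((rightDoubleDual A).obj D ≅ D) := by
  obtain ⟨i⟩ := h.nonempty_rightDual_iso
  obtain ⟨j⟩ := h.symm.nonempty_rightDual_iso
  exact ⟨(rightDualFunctor A).mapIso i.symm.op ≪≫ j⟩

/-- The right adjoint of `D ⊗ (-)^∨∨ ≅ (D ⊗ -)^∨∨` is `E ⊗ ^∨∨(-)`. -/
lemma IsTensorInverse.nonempty_doubleDual_adj_left (hE : IsTensorInverse D E) :
    Nonempty (rightDoubleDual A ⋙ tensorLeft D ⊣
      leftDoubleDual A ⋙ tensorLeft E) := by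
  obtain ⟨adj⟩ := nonempty_rightDoubleDual_adj A
  obtain ⟨adj'⟩ := hE.nonempty_tensorLeft_adj
  obtain ⟨t⟩ := nonempty_tensorLeft_rightDoubleDual_iso D
  obtain ⟨j⟩ := hE.nonempty_rightDoubleDual_iso
  exact ⟨(adj'.comp adj).ofNatIsoLeft
    (t ≪≫ Functor.isoWhiskerLeft (rightDoubleDual A) (tensorLeftIso j))⟩

/-- The right adjoint of `^∨∨(-) ⊗ D` is `(- ⊗ E)^∨∨ ≅ (-)^∨∨ ⊗ E`. -/
lemma IsTensorInverse.nonempty_doubleDual_adj_right (hE : IsTensorInverse D E) :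
    Nonempty (leftDoubleDual A ⋙ tensorRight D ⊣
      rightDoubleDual A ⋙ tensorRight E) := by
  obtain ⟨adj⟩ := nonempty_leftDoubleDual_adj A
  obtain ⟨adj'⟩ := hE.nonempty_tensorRight_adj
  obtain ⟨t⟩ := nonempty_tensorRight_rightDoubleDual_iso E
  obtain ⟨j⟩ := hE.symm.nonempty_rightDoubleDual_iso
  exact ⟨(adj.comp adj').ofNatIsoRight
    (t ≪≫ Functor.isoWhiskerLeft (rightDoubleDual A) (tensorRightIso j))⟩

end Invertible

/-! ### The Nakayama functors of a finite multitensor category -/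

/-- A universal family with vertex the coend itself. -/
lemma exists_dualFamily_coend {k : Type w} [Field k] {C : Type u} [Category.{v} C]
    [Preadditive C] [Linear k C] [IsFiniteLinear k C] {P : C} (hP : IsRegularGenerator k P)
    (x : C) [HasCoend (dualHomTensor k x)] :
    ∃ d : DualFamily k x (coend (dualHomTensor k x)), Function.Bijective (d.ι P) := by
  obtain ⟨n, d, hd⟩ := DualFamily.exists_bijective x hP
  obtain ⟨h⟩ := d.nonempty_isColimit hP hd
  let i : n ≅ coend (dualHomTensor k x) := h.coconePointUniqueUpToIso (colimit.isColimit _)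
  exact ⟨⟨fun a => (postcompₗ k a i).toLinearMap ∘ₗ d.ι a, fun g ξ => by
    change g ≫ d.ι _ ξ ≫ i.hom = d.ι _ _ ≫ i.hom
    rw [← d.comp_ι, Category.assoc]⟩, (postcompₗ k P i).bijective.comp hd⟩

section

variable {k : Type w} [Field k] {A : Type u} [Category.{v} A] [Preadditive A] [Linear k A]
  [IsFiniteLinear k A] [MonoidalCategory A] [MonoidalPreadditive A] [MonoidalLinear k A]
  [RigidCategory A] {P D : A} (hP : IsRegularGenerator k P) (d : DualFamily k (𝟙_ A) D)
  (hd : Function.Bijective (d.ι P))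

include hP hd in
lemma DualFamily.nonempty_nakayamaR_iso_left [∀ x : A, HasCoend (dualHomTensor k x)] :
    Nonempty (nakayamaR k A ≅ rightDoubleDual A ⋙ tensorLeft D) :=
  nonempty_nakayamaR_iso hP _ d.tensorDoubleDual (d.tensorDoubleDual_bijective hP hd)
    d.tensorDoubleDual_map

include hP hd in
lemma DualFamily.nonempty_nakayamaR_iso_right [∀ x : A, HasCoend (dualHomTensor k x)] :
    Nonempty (nakayamaR k A ≅ leftDoubleDual A ⋙ tensorRight D) :=
  nonempty_nakayamaR_iso hP _ d.doubleDualTensor (d.doubleDualTensor_bijective hP hd)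
    d.doubleDualTensor_map

include hP hd in
/-- The left dual of `D` is an inverse: it is a left inverse by
`DualFamily.nonempty_leftDual_tensor_iso`, and the isomorphism `D ⊗ x^∨∨ ≅ ^∨∨x ⊗ D` gives a right
inverse. -/
lemma DualFamily.isTensorInverse_leftDual : IsTensorInverse D (ᘁD) := by
  have (x : A) : HasCoend (dualHomTensor k x) := hasCoend_dualHomTensor x
  obtain ⟨i⟩ := d.nonempty_leftDual_tensor_iso hP hd
  obtain ⟨l⟩ := d.nonempty_nakayamaR_iso_left hP hd
  obtain ⟨r⟩ := d.nonempty_nakayamaR_iso_right hP hd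
  obtain ⟨c⟩ := nonempty_rightDoubleDual_leftDoubleDual_iso A
  let y : A := (rightDoubleDual A).obj (ᘁD)
  exact isTensorInverse_of_iso i ((l.symm ≪≫ r).app y ≪≫ whiskerRightIso (c.app (ᘁD)) D ≪≫ i)

end

end FiniteMultitensor

end

theorem corollary4p9 (k : Type w) [Field k] [IsAlgClosed k]
    (A : Type u) [Category.{v} A] [Preadditive A] [Linear k A] [IsFiniteLinear k A]
    [MonoidalCategory A] [MonoidalPreadditive A] [MonoidalLinear k A] [RigidCategory A] :
    ∃ (_ : ∀ x : A, HasEnd (homTensor k x)) (_ : ∀ x : A, HasCoend (dualHomTensor k x)),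
      let D : A := end_ (homTensor k (𝟙_ A))
      let D' : A := coend (dualHomTensor k (𝟙_ A))
      Nonempty (nakayamaL k A ≅ leftDoubleDual A ⋙ tensorLeft D) ∧
      Nonempty (nakayamaL k A ≅ rightDoubleDual A ⋙ tensorRight D) ∧
      Nonempty (nakayamaR k A ≅ rightDoubleDual A ⋙ tensorLeft D') ∧
      Nonempty (nakayamaR k A ≅ leftDoubleDual A ⋙ tensorRight D') ∧
      IsTensorInverse D D' ∧
      ∀ E : A, IsTensorInverse D E →
        Nonempty (rightDoubleDual A ⋙ rightDoubleDual A ≅ tensorLeft D ⋙ tensorRight E) := by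
  obtain ⟨P, hP⟩ := exists_isRegularGenerator k A
  have hC (x : A) : HasCoend (dualHomTensor k x) := hasCoend_dualHomTensor x
  obtain ⟨d, hd⟩ := exists_dualFamily_coend hP (𝟙_ A)
  have hE := d.isTensorInverse_leftDual hP hd
  obtain ⟨adjL⟩ := hE.nonempty_doubleDual_adj_left
  obtain ⟨adjR⟩ := hE.nonempty_doubleDual_adj_right
  have hW (x : A) : HasEnd (homTensor k x) :=
    hasEnd_homTensor hP adjL d.tensorDoubleDual (d.tensorDoubleDual_bijective hP hd)
      d.tensorDoubleDual_map x
  obtain ⟨l⟩ := nonempty_nakayamaL_iso hP adjL d.tensorDoubleDual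
    (d.tensorDoubleDual_bijective hP hd) d.tensorDoubleDual_map
  obtain ⟨r⟩ := nonempty_nakayamaL_iso hP adjR d.doubleDualTensor
    (d.doubleDualTensor_bijective hP hd) d.doubleDualTensor_map
  -- the value of `N^l` at the unit is the inverse of the value of `N^r` at the unit
  have hu : IsTensorInverse (𝟙_ A) (𝟙_ A) := ⟨⟨λ_ _⟩, ⟨λ_ _⟩⟩
  obtain ⟨u⟩ := hu.nonempty_rightDoubleDual_iso
  let e : end_ (homTensor k (𝟙_ A)) ≅ (ᘁ(coend (dualHomTensor k (𝟙_ A))) : A) :=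
    r.app (𝟙_ A) ≪≫ whiskerRightIso u _ ≪≫ λ_ _
  let l' := l ≪≫ Functor.isoWhiskerLeft (leftDoubleDual A) (tensorLeftIso e.symm)
  let r' := r ≪≫ Functor.isoWhiskerLeft (rightDoubleDual A) (tensorRightIso e.symm)
  refine ⟨hW, hC, ⟨l'⟩, ⟨r'⟩, d.nonempty_nakayamaR_iso_left hP hd,
    d.nonempty_nakayamaR_iso_right hP hd, hE.symm.congr e.symm (Iso.refl _), fun E h => ?_⟩
  obtain ⟨c⟩ := nonempty_rightDoubleDual_leftDoubleDual_iso A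
  obtain ⟨b⟩ := h.nonempty_tensorRight_comp
  -- `D ⊗ x ≅ D ⊗ ^∨∨(x^∨∨) ≅ x^∨∨∨∨ ⊗ D`
  let s : tensorLeft (end_ (homTensor k (𝟙_ A))) ≅
      (rightDoubleDual A ⋙ rightDoubleDual A) ⋙ tensorRight (end_ (homTensor k (𝟙_ A))) :=
    (Functor.isoWhiskerRight c (tensorLeft _)).symm ≪≫
      Functor.isoWhiskerLeft (rightDoubleDual A) (l'.symm ≪≫ r')
  exact ⟨(Functor.isoWhiskerRight s (tensorRight E) ≪≫
    Functor.isoWhiskerLeft (rightDoubleDual A ⋙ rightDoubleDual A) b).symm⟩
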